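/- Notation. For $0<q<1$ put $(x;q)_n=\prod_{k=0}^{n-1}(1-xq^k)$, $(x;q)_\infty=\prod_{k=0}^{\infty}(1-xq^k)$, $(x_1,\dots,x_r;q)_n=\prod_i(x_i;q)_n$ for $n\in\mathbb N_0\cup\{\infty\}$, and $\Omega_q=\{q^{-k}:k\in\mathbb N_0\}$; $t^{\pm}$ in a list of parameters stands for the two entries with $t$ and with $t^{-1}$. Let $${}_4\phi_3\!\left(\begin{matrix}a_1,\dots,a_4\\ b_1,b_2,b_3\end{matrix};q,z\right)=\sum_{k\ge0}\frac{(a_1,\dots,a_4;q)_k}{(q,b_1,b_2,b_3;q)_k}z^k .$$ **Theorem 7.1.** Let $0<q<1$ and $t,a,b,c,d\in\mathbb C\setminus\{0\}$ with $ab=cd$ and $\frac{qt}{ac},\frac{q}{act}\notin\Omega_q$. For $l,m\in\mathbb N_0$ put $$R_{l,m}(t)={}_4\phi_3\!\left(\begin{matrix}q^{-l},\frac{q^l}{c^2},\frac{qat}{c},\frac{qbt}{c}\\ \frac{q^{1-m}at}{c},\frac{q^{m+1}t}{ac},\frac{qd}{c}\end{matrix};q,q\right),\qquad K=\frac{(\frac{q}{a^2},\frac{q}{c^2},\frac{qbt^\pm}{c};q)_\infty}{(\frac{qb}{a},\frac{qd}{c},\frac{qt^\pm}{ac};q)_\infty}.$$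 (1) Suppose $|qb|<|a|$, $\frac1{ab}\notin\Omega_q$, $\frac{qd}{c}\notin\Omega_q$ and $c^2\ne1$. Let $m,m'\in\mathbb N_0$ be such that $\frac{q^{1-m}at}{c},\frac{q^{1-m'}a}{ct}\notin\Omega_q$, $a^2\neq q^{2m}$, and $a^2\ne q^k$ for $0\le k<m$. Then $$\sum_{l=0}^\infty\frac{1-\frac{q^{2l}}{c^2}}{1-\frac1{c^2}}\,\frac{(\frac{qd}{c},\frac1{c^2};q)_l}{(q,\frac1{ab};q)_l}\Big(\frac{c}{qd}\Big)^lR_{l,m}(t)R_{l,m'}(t^{-1})=K\Big(\frac{c}{qd}\Big)^m\frac{1-\frac1{a^2}}{1-\frac{q^{2m}}{a^2}}\,\frac{(q,\frac{qb}{a},\frac{qt^\pm}{ac};q)_m}{(\frac1{a^2},\frac1{ab},\frac{ct^\pm}{a};q)_m}\,\delta_{m,m'}$$ (the right-hand side being $0$ for $m\neq m'$). (2) Suppose $|qd|<|c|$, $\frac{qb}{a}\notin\Omega_q$, $a^2\neq1$, and $\frac{q^{1-m}at}{c},\frac{q^{1-m}a}{ct}\notin\Omega_q$ for all $m\in\mathbb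 N_0$. Let $l,l'\in\mathbb N_0$ be such that $c^2\ne q^{2l}$ and $c^2\neq q^k$ for $0\le k<l$. Then $$\sum_{m=0}^\infty\frac{1-\frac{q^{2m}}{a^2}}{1-\frac1{a^2}}\,\frac{(\frac1{a^2},\frac1{ab},\frac{ct^\pm}{a};q)_m}{(q,\frac{qb}{a},\frac{qt^\pm}{ac};q)_m}\Big(\frac{qd}{c}\Big)^mR_{l,m}(t)R_{l',m}(t^{-1})=K\Big(\frac{qd}{c}\Big)^l\frac{1-\frac1{c^2}}{1-\frac{q^{2l}}{c^2}}\,\frac{(q,\frac1{cd};q)_l}{(\frac1{c^2},\frac{qd}{c};q)_l}\,\delta_{l,l'}.$$ Both series converge absolutely. -/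

import Mathlib

noncomputable section

/-- The finite `q`-shifted factorial `(a;q)_n = (1-a)(1-aq)⋯(1-aq^{n-1})`. -/
def qPoch (a q : ℂ) (n : ℕ) : ℂ :=
  ∏ k ∈ Finset.range n, (1 - a * q ^ k)

/-- The infinite `q`-shifted factorial `(a;q)_∞` (a convergent product for `|q| < 1`). -/
def qPochInf (a q : ℂ) : ℂ :=
  ∏' k : ℕ, (1 - a * q ^ k)

/-- `(a₁,…,a_r;q)_n = (a₁;q)_n ⋯ (a_r;q)_n`. -/
def qPochs (as : List ℂ) (q : ℂ) (n : ℕ) : ℂ :=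
  (as.map fun a => qPoch a q n).prod

/-- `(a₁,…,a_r;q)_∞ = (a₁;q)_∞ ⋯ (a_r;q)_∞`. -/
def qPochsInf (as : List ℂ) (q : ℂ) : ℂ :=
  (as.map fun a => qPochInf a q).prod

/-- The set `Ω_q = {q^{-k} : k ∈ ℕ₀}` of forbidden lower parameters:
for `q ≠ 0`, `x ∉ Ω_q` iff `(x;q)_n ≠ 0` for all `n`. -/
def qOmega (q : ℂ) : Set ℂ :=
  {x | ∃ k : ℕ, x = q ^ (-(k : ℤ))}

/-- The basic hypergeometric series `_rφ_s(a₁,…,a_r; b₁,…,b_s; q, z)`. -/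
def basicHyp (as bs : List ℂ) (q z : ℂ) : ℂ :=
  ∑' k : ℕ, qPochs as q k / qPochs (q :: bs) q k
    * ((-1) ^ k * q ^ (k.choose 2)) ^ (1 + (bs.length : ℤ) - (as.length : ℤ)) * z ^ k

/-- The rational balanced (for `ab = cd`) `₄φ₃`-function
`₄φ₃(q^{-l}, q^l/c², qat/c, qbt/c; q^{1-m}at/c, q^{m+1}t/(ac), qd/c; q, q)`. -/
def rationalPhi (q t a b c d : ℂ) (l m : ℕ) : ℂ :=
  basicHyp
    [q ^ (-(l : ℤ)), q ^ l / c ^ 2, q * a * t / c, q * b * t / c]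
    [q ^ (1 - (m : ℤ)) * a * t / c, q ^ (m + 1) * t / (a * c), q * d / c]
    q q

/-- The constant
`(q/a², q/c², qbt/c, qb/(ct); q)_∞ / (qb/a, qd/c, qt/(ac), q/(act); q)_∞`. -/
def bioConst (q t a b c d : ℂ) : ℂ :=
  qPochsInf [q / a ^ 2, q / c ^ 2, q * b * t / c, q * b * t⁻¹ / c] q
    / qPochsInf [q * b / a, q * d / c, q * t / (a * c), q * t⁻¹ / (a * c)] q

end

/-!
Put `y = 1/c²`, `A = 1/a²`, `B = 1/(ab)`, `v = qt/(ac)` and `v' = q/(act)`, so that `vv' = q²yA`.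
As a function of `m`, each term of the `₄φ₃` is a multiple of a basis function; the product of a
basis function in `v` and one in `v'` is summed against the weight by the nonterminating
very-well-poised `₆φ₅` formula, which follows from a telescoping relation between the parameters
`A` and `qA`. The resulting kernel in the two basis indices is diagonalized by the
`q`-Saalschütz sum; this is the relation summed over `m`. Writing one of the factors of the `₄φ₃`
as a `q`-Saalschütz sum shows that, up to an explicit factor, it is symmetric under
`(y, l) ↔ (A, m)`, so the relation summed over `l` is the same relation with the roles exchanged.
-/

open Filter Topology

section QPochhammer

variable {q : ℂ}

theorem qPoch_zero (x q : ℂ) : qPoch x q 0 = 1 := by simp [qPoch]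

theorem qPoch_succ (x q : ℂ) (n : ℕ) : qPoch x q (n + 1) = qPoch x q n * (1 - x * q ^ n) := by
  simp [qPoch, Finset.prod_range_succ]

theorem qPoch_add (x q : ℂ) (m n : ℕ) :
    qPoch x q (m + n) = qPoch x q m * qPoch (x * q ^ m) q n := by
  simp only [qPoch, Finset.prod_range_add, pow_add, mul_assoc]

theorem qPoch_succ_left (x q : ℂ) (n : ℕ) :
    qPoch x q (n + 1) = (1 - x) * qPoch (x * q) q n := by
  rw [add_comm, qPoch_add]
  simp [qPoch]

theorem qPoch_eq_prod_one_add (x q : ℂ) (n : ℕ) :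
    qPoch x q n = ∏ k ∈ Finset.range n, (1 + -(x * q ^ k)) := by
  simp only [qPoch, sub_eq_add_neg]

theorem qPochInf_eq_tprod_one_add (x q : ℂ) : qPochInf x q = ∏' k : ℕ, (1 + -(x * q ^ k)) := by
  simp only [qPochInf, sub_eq_add_neg]

theorem one_sub_mul_pow_ne_zero {x : ℂ} (hx : x ∉ qOmega q) (n : ℕ) : 1 - x * q ^ n ≠ 0 := by
  intro h
  refine hx ⟨n, ?_⟩
  rw [zpow_neg, zpow_natCast]
  exact eq_inv_of_mul_eq_one_left (sub_eq_zero.mp h).symm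

theorem qPoch_ne_zero {x : ℂ} (hx : x ∉ qOmega q) (n : ℕ) : qPoch x q n ≠ 0 :=
  Finset.prod_ne_zero_iff.mpr fun k _ => one_sub_mul_pow_ne_zero hx k

theorem notMem_qOmega_of_norm_lt_one {x : ℂ} (hq : q ≠ 0) (hq1 : ‖q‖ < 1) (hx : ‖x‖ < 1) :
    x ∉ qOmega q := by
  rintro ⟨k, rfl⟩
  rw [zpow_neg, zpow_natCast, norm_inv, norm_pow] at hx
  exact absurd hx (not_lt.mpr ((one_le_inv₀ (pow_pos (norm_pos_iff.mpr hq) k)).mpr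
    (pow_le_one₀ (norm_nonneg _) hq1.le)))

theorem qPoch_self_ne_zero (hq : q ≠ 0) (hq1 : ‖q‖ < 1) (n : ℕ) : qPoch q q n ≠ 0 :=
  qPoch_ne_zero (notMem_qOmega_of_norm_lt_one hq hq1 hq1) n

theorem summable_norm_neg_mul_pow (hq1 : ‖q‖ < 1) (x : ℂ) :
    Summable fun k : ℕ => ‖-(x * q ^ k)‖ := by
  simp only [norm_neg, norm_mul, norm_pow]
  exact (summable_geometric_of_lt_one (norm_nonneg q) hq1).mul_left _

theorem tendsto_qPoch (hq1 : ‖q‖ < 1) (x : ℂ) :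
    Tendsto (fun n => qPoch x q n) atTop (𝓝 (qPochInf x q)) := by
  simp only [qPoch_eq_prod_one_add, qPochInf_eq_tprod_one_add]
  exact (multipliable_one_add_of_summable
    (summable_norm_neg_mul_pow hq1 x)).hasProd.tendsto_prod_nat

theorem qPochInf_ne_zero {x : ℂ} (hq1 : ‖q‖ < 1) (hx : x ∉ qOmega q) : qPochInf x q ≠ 0 := by
  rw [qPochInf_eq_tprod_one_add]
  exact tprod_one_add_ne_zero_of_summable
    (fun k => by simpa [sub_eq_add_neg] using one_sub_mul_pow_ne_zero hx k)
    (summable_norm_neg_mul_pow hq1 x)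

theorem qPoch_mul_qPochInf (hq1 : ‖q‖ < 1) (x : ℂ) (n : ℕ) :
    qPoch x q n * qPochInf (x * q ^ n) q = qPochInf x q := by
  refine tendsto_nhds_unique ((tendsto_qPoch hq1 (x * q ^ n)).const_mul (qPoch x q n)) ?_
  simp only [← qPoch_add, add_comm n]
  exact (tendsto_add_atTop_iff_nat n).mpr (tendsto_qPoch hq1 x)

theorem one_sub_mul_qPochInf (hq1 : ‖q‖ < 1) (x : ℂ) :
    (1 - x) * qPochInf (x * q) q = qPochInf x q := by
  simpa [qPoch] using qPoch_mul_qPochInf hq1 x 1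

theorem qPochInf_mul_pow_ne_zero {x : ℂ} (hq1 : ‖q‖ < 1) (hx : x ∉ qOmega q) (n : ℕ) :
    qPochInf (x * q ^ n) q ≠ 0 :=
  right_ne_zero_of_mul (qPoch_mul_qPochInf hq1 x n ▸ qPochInf_ne_zero hq1 hx)

theorem qPochInf_mul_pow (hq1 : ‖q‖ < 1) (x : ℂ) (n : ℕ) :
    qPochInf (x * q ^ n) q = (1 - x * q ^ n) * qPochInf (x * q ^ (n + 1)) q := by
  rw [← one_sub_mul_qPochInf hq1, pow_succ, mul_assoc]

theorem norm_qPoch_le {x : ℂ} {r : ℝ} (hq1 : ‖q‖ < 1) (hx : ‖x‖ ≤ r) (n : ℕ) :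
    ‖qPoch x q n‖ ≤ Real.exp (r * (1 - ‖q‖)⁻¹) := by
  have hsum : ∑ k ∈ Finset.range n, ‖-(x * q ^ k)‖ ≤ r * (1 - ‖q‖)⁻¹ := by
    simp only [norm_neg, norm_mul, norm_pow, ← Finset.mul_sum]
    rw [← tsum_geometric_of_lt_one (norm_nonneg q) hq1]
    gcongr
    · exact (norm_nonneg x).trans hx
    · exact (summable_geometric_of_lt_one (norm_nonneg q) hq1).sum_le_tsum _
        fun _ _ => by positivity
  have hexp := (Finset.range n).norm_prod_one_add_sub_one_le fun k => -(x * q ^ k)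
  rw [← qPoch_eq_prod_one_add] at hexp
  have htri := norm_le_norm_sub_add (qPoch x q n) 1
  rw [norm_one] at htri
  exact (by linarith : ‖qPoch x q n‖ ≤ _).trans (Real.exp_le_exp.mpr hsum)

theorem norm_qPochInf_le {x : ℂ} {r : ℝ} (hq1 : ‖q‖ < 1) (hx : ‖x‖ ≤ r) :
    ‖qPochInf x q‖ ≤ Real.exp (r * (1 - ‖q‖)⁻¹) :=
  le_of_tendsto (tendsto_qPoch hq1 x).norm (Eventually.of_forall (norm_qPoch_le hq1 hx))

theorem exists_norm_inv_qPoch_self_le (hq : q ≠ 0) (hq1 : ‖q‖ < 1) :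
    ∃ M, ∀ n, ‖(qPoch q q n)⁻¹‖ ≤ M := by
  have hlim := (tendsto_qPoch hq1 q).inv₀
    (qPochInf_ne_zero hq1 (notMem_qOmega_of_norm_lt_one hq hq1 hq1))
  obtain ⟨M, hM⟩ := (Metric.isBounded_range_of_tendsto _ hlim).exists_norm_le
  exact ⟨M, fun n => hM _ ⟨n, rfl⟩⟩

theorem continuous_qPoch (q : ℂ) (n : ℕ) : Continuous fun x => qPoch x q n := by
  unfold qPoch
  fun_prop

theorem continuous_qPochInf (hq1 : ‖q‖ < 1) : Continuous fun x => qPochInf x q := by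
  simp only [qPochInf_eq_tprod_one_add]
  refine continuous_iff_continuousAt.mpr fun x => ?_
  refine tendsto_tprod_one_add_of_dominated_convergence
    (bound := fun k => (‖x‖ + 1) * ‖q‖ ^ k)
    ((summable_geometric_of_lt_one (norm_nonneg q) hq1).mul_left _)
    (fun k => (by fun_prop : Continuous fun y : ℂ => -(y * q ^ k)).tendsto x) ?_
  filter_upwards [(continuous_norm.tendsto x).eventually_lt_const (lt_add_one _)] with y hy k
  rw [norm_neg, norm_mul, norm_pow]
  gcongr

theorem qPochInf_zero (q : ℂ) : qPochInf 0 q = 1 := by simp [qPochInf]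

theorem qPoch_inv_pow_eq_zero (hq : q ≠ 0) {n k : ℕ} (h : n < k) :
    qPoch (q ^ n)⁻¹ q k = 0 :=
  Finset.prod_eq_zero (Finset.mem_range.mpr h) (by simp [hq])

end QPochhammer

section WellPoised

variable {q : ℂ}

/-- The `n`-th term of the very-well-poised series
`₆φ₅(A, q√A, -q√A, B, C, D; √A, -√A, Aq/B, Aq/C, Aq/D; q, Aq/(BCD))`, stripped of the factor
`(1 - Aq²ⁿ)/(1 - A)` and multiplied by `(Aq/B, Aq/C, Aq/D; q)_∞`, which removes the poles in the
lower parameters. -/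
noncomputable def wellPoisedTerm (q A B C D : ℂ) (n : ℕ) : ℂ :=
  qPoch A q n * qPoch B q n * qPoch C q n * qPoch D q n / qPoch q q n
    * (qPochInf (A * q / B * q ^ n) q * qPochInf (A * q / C * q ^ n) q
      * qPochInf (A * q / D * q ^ n) q)
    * (A * q / (B * C * D)) ^ n

theorem exists_norm_wellPoisedTerm_le (hq : q ≠ 0) (hq1 : ‖q‖ < 1) (B C D : ℂ) (r : ℝ) :
    ∃ M, ∀ A, ‖A‖ ≤ r → ∀ n, ‖wellPoisedTerm q A B C D n‖ ≤ M * ‖A * q / (B * C * D)‖ ^ n := by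
  obtain ⟨M, hM⟩ := exists_norm_inv_qPoch_self_le hq hq1
  have hM0 := (norm_nonneg _).trans (hM 0)
  let K : ℝ → ℝ := fun x => Real.exp (x * (1 - ‖q‖)⁻¹)
  have hlower : ∀ A E : ℂ, ‖A‖ ≤ r → ∀ n, ‖qPochInf (A * q / E * q ^ n) q‖ ≤ K (r * ‖q‖ / ‖E‖) :=
    fun A E hA n => norm_qPochInf_le hq1 <| by
      rw [norm_mul, norm_div, norm_mul, norm_pow]
      have := (norm_nonneg A).trans hA
      exact (mul_le_of_le_one_right (by positivity)
        (pow_le_one₀ (norm_nonneg q) hq1.le)).trans (by gcongr)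
  refine ⟨K r * K ‖B‖ * K ‖C‖ * K ‖D‖ * M
    * (K (r * ‖q‖ / ‖B‖) * K (r * ‖q‖ / ‖C‖) * K (r * ‖q‖ / ‖D‖)), fun A hA n => ?_⟩
  simp only [wellPoisedTerm, div_eq_mul_inv _ (qPoch q q n), norm_mul, norm_pow]
  gcongr
  exacts [norm_qPoch_le hq1 hA n, norm_qPoch_le hq1 le_rfl n, norm_qPoch_le hq1 le_rfl n,
    norm_qPoch_le hq1 le_rfl n, hM n, hlower A B hA n, hlower A C hA n, hlower A D hA n]

theorem norm_one_sub_mul_pow_le {A : ℂ} {r : ℝ} (hq1 : ‖q‖ < 1) (hA : ‖A‖ ≤ r) (n : ℕ) :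
    ‖1 - A * q ^ n‖ ≤ 1 + r := by
  refine (norm_sub_le _ _).trans ?_
  rw [norm_one, norm_mul, norm_pow]
  gcongr
  exact (mul_le_of_le_one_right (norm_nonneg A) (pow_le_one₀ (norm_nonneg q) hq1.le)).trans hA

theorem summable_wellPoised {A B C D : ℂ} (hq : q ≠ 0) (hq1 : ‖q‖ < 1)
    (hz : ‖A * q / (B * C * D)‖ < 1) :
    Summable fun n => (1 - A * q ^ (2 * n)) * wellPoisedTerm q A B C D n := by
  obtain ⟨M, hM⟩ := exists_norm_wellPoisedTerm_le hq hq1 B C D ‖A‖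
  refine .of_norm_bounded
    (((summable_geometric_of_lt_one (norm_nonneg _) hz).mul_left M).mul_left (1 + ‖A‖)) fun n => ?_
  rw [norm_mul]
  gcongr
  · exact norm_one_sub_mul_pow_le hq1 le_rfl _
  · exact hM A le_rfl n

theorem tendsto_wellPoisedTerm_zero {A B C D : ℂ} (hq : q ≠ 0) (hq1 : ‖q‖ < 1)
    (hz : ‖A * q / (B * C * D)‖ < 1) : Tendsto (wellPoisedTerm q A B C D) atTop (𝓝 0) := by
  obtain ⟨M, hM⟩ := exists_norm_wellPoisedTerm_le hq hq1 B C D ‖A‖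
  refine squeeze_zero_norm (hM A le_rfl) ?_
  simpa using (tendsto_pow_atTop_nhds_zero_of_lt_one (norm_nonneg _) hz).const_mul M

theorem continuous_wellPoisedTerm (hq1 : ‖q‖ < 1) (B C D : ℂ) (n : ℕ) :
    Continuous fun A => wellPoisedTerm q A B C D n := by
  have hlower : ∀ E, Continuous fun A => qPochInf (A * q / E * q ^ n) q := fun E =>
    (continuous_qPochInf hq1).comp (by fun_prop)
  have := continuous_qPoch q n
  have := hlower B
  have := hlower C
  have := hlower D
  unfold wellPoisedTerm
  fun_prop

theorem tsum_wellPoised_zero (q B C D : ℂ) :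
    ∑' n, (1 - 0 * q ^ (2 * n)) * wellPoisedTerm q 0 B C D n = 1 := by
  rw [tsum_eq_single 0 fun n hn => by simp [wellPoisedTerm, hn]]
  simp [wellPoisedTerm, qPoch_zero, qPochInf_zero]

theorem tendsto_tsum_wellPoised {A B C D : ℂ} (hq : q ≠ 0) (hq1 : ‖q‖ < 1)
    (hz : ‖A * q / (B * C * D)‖ < 1) :
    Tendsto (fun N => ∑' n, (1 - A * q ^ N * q ^ (2 * n)) * wellPoisedTerm q (A * q ^ N) B C D n)
      atTop (𝓝 1) := by
  obtain ⟨M, hM⟩ := exists_norm_wellPoisedTerm_le hq hq1 B C D ‖A‖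
  have hM0 : 0 ≤ M := by simpa using (norm_nonneg _).trans (hM A le_rfl 0)
  have hqN : ∀ N, ‖q ^ N‖ ≤ 1 := fun N => by
    rw [norm_pow]; exact pow_le_one₀ (norm_nonneg q) hq1.le
  have hAN : ∀ N, ‖A * q ^ N‖ ≤ ‖A‖ := fun N => by
    rw [norm_mul]; exact mul_le_of_le_one_right (norm_nonneg A) (hqN N)
  have hzN : ∀ N, ‖A * q ^ N * q / (B * C * D)‖ ≤ ‖A * q / (B * C * D)‖ := fun N => by
    rw [show A * q ^ N * q / (B * C * D) = A * q / (B * C * D) * q ^ N by ring, norm_mul]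
    exact mul_le_of_le_one_right (norm_nonneg _) (hqN N)
  have hlim : Tendsto (fun N => A * q ^ N) atTop (𝓝 0) := by
    simpa using (tendsto_pow_atTop_nhds_zero_of_norm_lt_one hq1).const_mul A
  suffices h : Tendsto _ atTop (𝓝 (∑' n, (1 - 0 * q ^ (2 * n)) * wellPoisedTerm q 0 B C D n)) by
    rwa [tsum_wellPoised_zero] at h
  refine tendsto_tsum_of_dominated_convergence
    (bound := fun n => (1 + ‖A‖) * (M * ‖A * q / (B * C * D)‖ ^ n))
    (((summable_geometric_of_lt_one (norm_nonneg _) hz).mul_left M).mul_left (1 + ‖A‖))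
    (fun n => ?_) (Eventually.of_forall fun N n => ?_)
  · have hcont := continuous_wellPoisedTerm hq1 B C D n
    exact ((by fun_prop : Continuous fun x => (1 - x * q ^ (2 * n)) *
      wellPoisedTerm q x B C D n).tendsto 0).comp hlim
  · rw [norm_mul]
    gcongr
    · exact norm_one_sub_mul_pow_le hq1 (hAN N) _
    · exact (hM _ (hAN N) n).trans (by gcongr; exact hzN N)

-- With `x = qⁿ`, the identity of rational functions behind the telescoping in `n`.
theorem wellPoised_certificate {A B C D : ℂ} (x : ℂ) (hB : B ≠ 0) (hC : C ≠ 0) (hD : D ≠ 0) :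
    (1 - A * q / (B * C * D)) * (1 - A * x ^ 2)
        * ((1 - A * q / B * x) * (1 - A * q / C * x) * (1 - A * q / D * x))
      - (1 - A * q / (B * C)) * (1 - A * q / (B * D)) * (1 - A * q / (C * D))
        * ((1 - A * q * x ^ 2) * (1 - A * x) * x)
      = (A * (A * q / (B * C * D)) * (q * x) - 1) * (A * q / (B * C * D))
          * ((1 - A * x) * (1 - B * x) * (1 - C * x) * (1 - D * x))
        - (A * (A * q / (B * C * D)) * x - 1)
          * ((1 - x) * ((1 - A * q / B * x) * (1 - A * q / C * x) * (1 - A * q / D * x))) := by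
  field_simp
  ring

theorem wellPoised_telescope {A B C D : ℂ} (hq : q ≠ 0) (hq1 : ‖q‖ < 1)
    (hB : B ≠ 0) (hC : C ≠ 0) (hD : D ≠ 0) (n : ℕ) :
    (1 - A * q / (B * C * D)) * ((1 - A * q ^ (2 * n)) * wellPoisedTerm q A B C D n)
      - (1 - A) * ((1 - A * q / (B * C)) * (1 - A * q / (B * D)) * (1 - A * q / (C * D)))
        * ((1 - A * q * q ^ (2 * n)) * wellPoisedTerm q (A * q) B C D n)
      = (A * (A * q / (B * C * D)) * q ^ (n + 1) - 1)
          * ((1 - q ^ (n + 1)) * wellPoisedTerm q A B C D (n + 1))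
        - (A * (A * q / (B * C * D)) * q ^ n - 1)
          * ((1 - q ^ n) * wellPoisedTerm q A B C D n) := by
  have hcert := wellPoised_certificate (q := q) (A := A) (q ^ n) hB hC hD
  have hqn : (1 - q * q ^ n) * (1 - q * q ^ n)⁻¹ = 1 := mul_inv_cancel₀
    (one_sub_mul_pow_ne_zero (notMem_qOmega_of_norm_lt_one hq hq1 hq1) n)
  have hA : (1 - A) * qPoch (A * q) q n = qPoch A q n * (1 - A * q ^ n) := by
    rw [← qPoch_succ_left, qPoch_succ]
  have hshift : ∀ E, A * q * q / E * q ^ n = A * q / E * q ^ (n + 1) := fun E => by ring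
  simp only [wellPoisedTerm, qPoch_succ, hshift, qPochInf_mul_pow hq1 _ n]
  rw [div_mul_eq_div_div _ (qPoch q q n),
    show A * q * q / (B * C * D) = A * q / (B * C * D) * q by ring, mul_pow _ q,
    show q ^ (2 * n) = (q ^ n) ^ 2 by ring, pow_succ' q n]
  generalize q ^ n = x at *
  linear_combination qPoch B q n * qPoch C q n * qPoch D q n / qPoch q q n
    * (qPochInf (A * q / B * (q * x)) q * qPochInf (A * q / C * (q * x)) q
      * qPochInf (A * q / D * (q * x)) q) * (A * q / (B * C * D)) ^ n * (qPoch A q n * hcert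
    - (1 - A * q / (B * C)) * (1 - A * q / (B * D)) * (1 - A * q / (C * D))
      * (1 - A * q * x ^ 2) * x * hA
    - (A * (A * q / (B * C * D)) * (q * x) - 1) * (A * q / (B * C * D)) * qPoch A q n
      * ((1 - A * x) * (1 - B * x) * (1 - C * x) * (1 - D * x)) * hqn)

theorem tsum_wellPoised_eq_mul {A B C D : ℂ} (hq : q ≠ 0) (hq1 : ‖q‖ < 1)
    (hB : B ≠ 0) (hC : C ≠ 0) (hD : D ≠ 0) (hz : ‖A * q / (B * C * D)‖ < 1) :
    (1 - A * q / (B * C * D)) * ∑' n, (1 - A * q ^ (2 * n)) * wellPoisedTerm q A B C D n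
      = (1 - A) * ((1 - A * q / (B * C)) * (1 - A * q / (B * D)) * (1 - A * q / (C * D)))
        * ∑' n, (1 - A * q * q ^ (2 * n)) * wellPoisedTerm q (A * q) B C D n := by
  have hzq : ‖A * q * q / (B * C * D)‖ < 1 := by
    rw [show A * q * q / (B * C * D) = A * q / (B * C * D) * q by ring, norm_mul]
    exact mul_lt_one_of_nonneg_of_lt_one_left (norm_nonneg _) hz hq1.le
  have hdiff := ((summable_wellPoised hq hq1 hz).hasSum.mul_left (1 - A * q / (B * C * D))).sub
    ((summable_wellPoised hq hq1 hzq).hasSum.mul_left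
      ((1 - A) * ((1 - A * q / (B * C)) * (1 - A * q / (B * D)) * (1 - A * q / (C * D)))))
  simp only [wellPoised_telescope hq hq1 hB hC hD] at hdiff
  have hpow := tendsto_pow_atTop_nhds_zero_of_norm_lt_one hq1
  have htel : Tendsto (fun n => (A * (A * q / (B * C * D)) * q ^ n - 1)
      * ((1 - q ^ n) * wellPoisedTerm q A B C D n)) atTop (𝓝 0) := by
    simpa using ((hpow.const_mul (A * (A * q / (B * C * D)))).sub_const 1).mul
      ((hpow.const_sub 1).mul (tendsto_wellPoisedTerm_zero hq hq1 hz))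
  have hzero := hdiff.tendsto_sum_nat
  simp only [Finset.sum_range_sub (fun n => (A * (A * q / (B * C * D)) * q ^ n - 1)
    * ((1 - q ^ n) * wellPoisedTerm q A B C D n)), pow_zero, sub_self, zero_mul, mul_zero,
    sub_zero] at hzero
  exact sub_eq_zero.mp (tendsto_nhds_unique hzero htel)

theorem qPoch_mul_tsum_wellPoised {A B C D : ℂ} (hq : q ≠ 0) (hq1 : ‖q‖ < 1)
    (hB : B ≠ 0) (hC : C ≠ 0) (hD : D ≠ 0) (hz : ‖A * q / (B * C * D)‖ < 1) (N : ℕ) :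
    qPoch (A * q / (B * C * D)) q N * ∑' n, (1 - A * q ^ (2 * n)) * wellPoisedTerm q A B C D n
      = qPoch A q N * (qPoch (A * q / (B * C)) q N * qPoch (A * q / (B * D)) q N
          * qPoch (A * q / (C * D)) q N)
        * ∑' n, (1 - A * q ^ N * q ^ (2 * n)) * wellPoisedTerm q (A * q ^ N) B C D n := by
  induction N with
  | zero => simp [qPoch_zero]
  | succ N ih =>
    have hzN : ‖A * q ^ N * q / (B * C * D)‖ < 1 := by
      rw [show A * q ^ N * q / (B * C * D) = A * q / (B * C * D) * q ^ N by ring, norm_mul,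
        norm_pow]
      exact mul_lt_one_of_nonneg_of_lt_one_left (norm_nonneg _) hz
        (pow_le_one₀ (norm_nonneg q) hq1.le)
    have hstep := tsum_wellPoised_eq_mul hq hq1 hB hC hD hzN
    simp only [mul_assoc A (q ^ N) q, ← pow_succ] at hstep
    simp only [qPoch_succ]
    linear_combination (1 - A * q / (B * C * D) * q ^ N) * ih
      + qPoch A q N * (qPoch (A * q / (B * C)) q N * qPoch (A * q / (B * D)) q N
          * qPoch (A * q / (C * D)) q N) * hstep

theorem hasSum_wellPoised {A B C D : ℂ} (hq : q ≠ 0) (hq1 : ‖q‖ < 1)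
    (hB : B ≠ 0) (hC : C ≠ 0) (hD : D ≠ 0) (hz : ‖A * q / (B * C * D)‖ < 1) :
    HasSum (fun n => (1 - A * q ^ (2 * n)) * wellPoisedTerm q A B C D n)
      (qPochInf A q * (qPochInf (A * q / (B * C)) q * qPochInf (A * q / (B * D)) q
        * qPochInf (A * q / (C * D)) q) / qPochInf (A * q / (B * C * D)) q) := by
  have hlim := ((tendsto_qPoch hq1 A).mul (((tendsto_qPoch hq1 (A * q / (B * C))).mul
    (tendsto_qPoch hq1 (A * q / (B * D)))).mul (tendsto_qPoch hq1 (A * q / (C * D))))).mul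
      (tendsto_tsum_wellPoised hq hq1 hz)
  simp only [← qPoch_mul_tsum_wellPoised hq hq1 hB hC hD hz, mul_one] at hlim
  have hmul := tendsto_nhds_unique ((tendsto_qPoch hq1 _).mul_const _) hlim
  have hz0 := qPochInf_ne_zero hq1 (notMem_qOmega_of_norm_lt_one hq hq1 hz)
  rw [← hmul, mul_div_cancel_left₀ _ hz0]
  exact (summable_wellPoised hq hq1 hz).hasSum

end WellPoised

section Saalschutz

variable {q : ℂ}

/-- The coefficient `(q⁻ⁿ, qⁿy; q)_k qᵏ / (q; q)_k` of the terminating balanced series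
`ᵣ₊₂φᵣ₊₁(q⁻ⁿ, qⁿy, …; …; q, q)`. -/
noncomputable def balancedCoeff (q y : ℂ) (n k : ℕ) : ℂ :=
  qPoch (q ^ n)⁻¹ q k * qPoch (q ^ n * y) q k / qPoch q q k * q ^ k

theorem balancedCoeff_zero (q y : ℂ) (n : ℕ) : balancedCoeff q y n 0 = 1 := by
  simp [balancedCoeff, qPoch_zero]

theorem balancedCoeff_eq_zero (hq : q ≠ 0) (y : ℂ) {n k : ℕ} (h : n < k) :
    balancedCoeff q y n k = 0 := by
  simp [balancedCoeff, qPoch_inv_pow_eq_zero hq h]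

/-- The `j`-th term of the terminating balanced series `₃φ₂(q⁻ⁿ, qⁿy, B; C, E; q, q)`, multiplied
by `(C, E; q)_∞` to remove the poles in `C` and `E`. -/
noncomputable def saalschutzTerm (q y B C E : ℂ) (n j : ℕ) : ℂ :=
  balancedCoeff q y n j * qPoch B q j * (qPochInf (C * q ^ j) q * qPochInf (E * q ^ j) q)

theorem saalschutzTerm_succ_zero (hq1 : ‖q‖ < 1) (y B C E : ℂ) (n : ℕ) :
    saalschutzTerm q y B C E (n + 1) 0 = (1 - E) * saalschutzTerm q (q * y) B C (q * E) n 0 := by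
  simp only [saalschutzTerm, balancedCoeff_zero, qPoch_zero, pow_zero, mul_one, one_mul,
    ← one_sub_mul_qPochInf hq1 E, mul_comm q E]
  ring

theorem saalschutzTerm_succ_succ (hq : q ≠ 0) (hq1 : ‖q‖ < 1) (y B C E : ℂ) (n j : ℕ) :
    saalschutzTerm q y B C E (n + 1) (j + 1)
      = (1 - E) * saalschutzTerm q (q * y) B C (q * E) n (j + 1)
        - (q ^ n)⁻¹ * (1 - E * q ^ (n + 1)) * (1 - B) * (1 - q ^ (n + 1) * y)
          * saalschutzTerm q (q ^ 2 * y) (q * B) (q * C) (q ^ 2 * E) n j := by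
  have hqj : 1 - q * q ^ j ≠ 0 :=
    one_sub_mul_pow_ne_zero (notMem_qOmega_of_norm_lt_one hq hq1 hq1) j
  have hqq := qPoch_self_ne_zero hq hq1 j
  simp only [saalschutzTerm, balancedCoeff]
  rw [show q ^ n * (q * y) = q ^ (n + 1) * y by ring,
    show q ^ n * (q ^ 2 * y) = q ^ (n + 1) * y * q by ring, mul_comm q B,
    show q * C * q ^ j = C * q ^ (j + 1) by ring,
    show q * E * q ^ (j + 1) = E * q ^ (j + 1 + 1) by ring,
    show q ^ 2 * E * q ^ j = E * q ^ (j + 1 + 1) by ring, qPochInf_mul_pow hq1 E (j + 1),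
    qPoch_succ_left (q ^ (n + 1))⁻¹, qPoch_succ_left (q ^ (n + 1) * y), qPoch_succ_left B,
    show (q ^ (n + 1))⁻¹ * q = (q ^ n)⁻¹ by rw [pow_succ]; field_simp, qPoch_succ (q ^ n)⁻¹,
    qPoch_succ q]
  field_simp
  ring

theorem sum_saalschutzTerm_succ (hq : q ≠ 0) (hq1 : ‖q‖ < 1) (y B C E : ℂ) (n : ℕ) :
    ∑ j ∈ Finset.range (n + 2), saalschutzTerm q y B C E (n + 1) j
      = (1 - E) * ∑ j ∈ Finset.range (n + 1), saalschutzTerm q (q * y) B C (q * E) n j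
        - (q ^ n)⁻¹ * (1 - E * q ^ (n + 1)) * (1 - B) * (1 - q ^ (n + 1) * y)
          * ∑ j ∈ Finset.range (n + 1),
            saalschutzTerm q (q ^ 2 * y) (q * B) (q * C) (q ^ 2 * E) n j := by
  have hlast : saalschutzTerm q (q * y) B C (q * E) n (n + 1) = 0 := by
    simp [saalschutzTerm, balancedCoeff_eq_zero hq _ n.lt_succ_self]
  have hsum := Finset.sum_range_succ (saalschutzTerm q (q * y) B C (q * E) n) (n + 1)
  rw [hlast, add_zero, Finset.sum_range_succ'] at hsum
  rw [Finset.sum_range_succ']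
  simp only [saalschutzTerm_succ_succ hq hq1, saalschutzTerm_succ_zero hq1,
    Finset.sum_sub_distrib, ← Finset.mul_sum]
  rw [sub_add_eq_add_sub, ← mul_add, hsum]

theorem sum_saalschutzTerm {y B C E : ℂ} (hq : q ≠ 0) (hq1 : ‖q‖ < 1) (hB : B ≠ 0)
    (h : C * E = q * y * B) (n : ℕ) :
    ∑ j ∈ Finset.range (n + 1), saalschutzTerm q y B C E n j
      = B ^ n * qPoch (C / B) q n * qPoch (E / B) q n
        * (qPochInf (C * q ^ n) q * qPochInf (E * q ^ n) q) := by
  induction n generalizing y B C E with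
  | zero => simp [saalschutzTerm, balancedCoeff_zero, qPoch_zero]
  | succ n ih =>
    rw [sum_saalschutzTerm_succ hq hq1,
      ih (y := q * y) (C := C) (E := q * E) hB (by linear_combination q * h),
      ih (y := q ^ 2 * y) (B := q * B) (C := q * C) (E := q ^ 2 * E) (mul_ne_zero hq hB)
        (by linear_combination q ^ 3 * h),
      mul_div_mul_left C B hq,
      show q * E / B = E / B * q by ring, show q ^ 2 * E / (q * B) = E / B * q by field_simp,
      show q * E * q ^ n = E * q ^ (n + 1) by ring, show q * C * q ^ n = C * q ^ (n + 1) by ring,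
      show q ^ 2 * E * q ^ n = E * q ^ (n + 1 + 1) by ring, qPochInf_mul_pow hq1 E (n + 1),
      qPochInf_mul_pow hq1 C n, qPoch_succ_left (E / B), qPoch_succ (C / B)]
    have hfactor : (1 - E) * (1 - C * q ^ n) - (1 - B) * (1 - q ^ (n + 1) * y)
        = B * (1 - C / B * q ^ n) * (1 - E / B) := by
      field_simp
      linear_combination (B - 1) * q ^ n * h
    have hqn : (q ^ n)⁻¹ * q ^ n = 1 := inv_mul_cancel₀ (pow_ne_zero n hq)
    linear_combination B ^ n * qPoch (C / B) q n * qPoch (E / B * q) q n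
      * (qPochInf (C * q ^ (n + 1)) q * (1 - E * q ^ (n + 1)) * qPochInf (E * q ^ (n + 1 + 1)) q)
      * (hfactor - (1 - B) * (1 - q ^ (n + 1) * y) * hqn)

end Saalschutz

section Orthogonality

variable {q : ℂ}

/-- The kernel `(Cqᵏ, Cqʲ, yqᵏ⁺ʲ⁺¹; q)_∞ / (Cqᵏ⁺ʲ; q)_∞`, in a form without poles, against which the
sequences `balancedCoeff q y n` are orthogonal for distinct `n`. -/
noncomputable def balancedKernel (q y C : ℂ) (k j : ℕ) : ℂ :=
  qPoch (C * q ^ k) q j * qPochInf (C * q ^ j) q * qPochInf (q * y * q ^ (k + j)) q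

theorem balancedKernel_comm (hq1 : ‖q‖ < 1) (y C : ℂ) (k j : ℕ) :
    balancedKernel q y C k j = balancedKernel q y C j k := by
  simp only [balancedKernel]
  rw [← qPoch_mul_qPochInf hq1 (C * q ^ j) k, ← qPoch_mul_qPochInf hq1 (C * q ^ k) j,
    show C * q ^ j * q ^ k = C * q ^ k * q ^ j by ring, add_comm j k]
  ring

theorem sum_balancedCoeff_mul_balancedKernel {C : ℂ} (hq : q ≠ 0) (hq1 : ‖q‖ < 1) (hC : C ≠ 0)
    (y : ℂ) (n k : ℕ) :
    ∑ j ∈ Finset.range (n + 1), balancedCoeff q y n j * balancedKernel q y C k j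
      = (C * q ^ k) ^ n * qPoch (q ^ k)⁻¹ q n * qPoch (q * y / C) q n
        * (qPochInf (C * q ^ n) q * qPochInf (q * y * q ^ (k + n)) q) := by
  have hk := pow_ne_zero k hq
  have hterm : ∀ j, balancedCoeff q y n j * balancedKernel q y C k j
      = saalschutzTerm q y (C * q ^ k) C (q * y * q ^ k) n j := fun j => by
    rw [balancedKernel, saalschutzTerm, pow_add, mul_assoc (q * y)]
    ring
  simp only [hterm]
  rw [sum_saalschutzTerm hq hq1 (mul_ne_zero hC hk) (by ring), div_mul_cancel_left₀ hC,
    mul_div_mul_right _ _ hk, pow_add, mul_assoc (q * y)]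

theorem qPoch_inv_pow_sq (hq : q ≠ 0) (n : ℕ) :
    qPoch (q ^ n)⁻¹ q n ^ 2 * q ^ (n * (n + 1)) = qPoch q q n ^ 2 := by
  induction n with
  | zero => simp [qPoch_zero]
  | succ n ih =>
    have hqn : q ^ n ≠ 0 := pow_ne_zero _ hq
    rw [qPoch_succ_left, show (q ^ (n + 1))⁻¹ * q = (q ^ n)⁻¹ by rw [pow_succ]; field_simp,
      qPoch_succ, mul_pow (qPoch q q n), ← ih,
      show q ^ ((n + 1) * (n + 1 + 1)) = q ^ (n * (n + 1)) * (q ^ n * q) ^ 2 by ring, pow_succ q n]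
    field_simp
    ring

theorem sum_sum_balancedKernel_of_lt {C : ℂ} (hq : q ≠ 0) (hq1 : ‖q‖ < 1) (hC : C ≠ 0) (y : ℂ)
    {l l' : ℕ} (h : l < l') :
    ∑ k ∈ Finset.range (l + 1), ∑ j ∈ Finset.range (l' + 1),
      balancedCoeff q y l k * balancedCoeff q y l' j * balancedKernel q y C k j = 0 := by
  refine Finset.sum_eq_zero fun k hk => ?_
  have hkl : k < l' := (Finset.mem_range_succ_iff.mp hk).trans_lt h
  simp only [mul_assoc, ← Finset.mul_sum]
  rw [sum_balancedCoeff_mul_balancedKernel hq hq1 hC, qPoch_inv_pow_eq_zero hq hkl]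
  ring

theorem sum_sum_balancedKernel_self {C : ℂ} (hq : q ≠ 0) (hq1 : ‖q‖ < 1) (hC : C ≠ 0) (y : ℂ)
    (l : ℕ) :
    ∑ k ∈ Finset.range (l + 1), ∑ j ∈ Finset.range (l + 1),
      balancedCoeff q y l k * balancedCoeff q y l j * balancedKernel q y C k j
      = qPoch q q l * qPoch (q * y / C) q l * C ^ l * qPochInf (C * q ^ l) q
        * (qPoch (y * q ^ l) q l * qPochInf (y * q ^ (2 * l + 1)) q) := by
  simp only [mul_assoc (balancedCoeff q y l _), ← Finset.mul_sum]
  rw [Finset.sum_range_succ, Finset.sum_eq_zero fun k hk => by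
    rw [sum_balancedCoeff_mul_balancedKernel hq hq1 hC,
      qPoch_inv_pow_eq_zero hq (Finset.mem_range.mp hk)]
    ring]
  have hsq := qPoch_inv_pow_sq hq l
  have hqq := mul_inv_cancel₀ (qPoch_self_ne_zero hq hq1 l)
  rw [sum_balancedCoeff_mul_balancedKernel hq hq1 hC, balancedCoeff, mul_comm (q ^ l) y,
    show q * y * q ^ (l + l) = y * q ^ (2 * l + 1) by ring, zero_add]
  linear_combination (qPoch (y * q ^ l) q l * C ^ l * qPoch (q * y / C) q l
    * qPochInf (C * q ^ l) q * qPochInf (y * q ^ (2 * l + 1)) q)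
    * ((qPoch q q l)⁻¹ * hsq + qPoch q q l * hqq)

theorem sum_sum_balancedKernel {C : ℂ} (hq : q ≠ 0) (hq1 : ‖q‖ < 1) (hC : C ≠ 0) (y : ℂ)
    (l l' : ℕ) :
    ∑ k ∈ Finset.range (l + 1), ∑ j ∈ Finset.range (l' + 1),
      balancedCoeff q y l k * balancedCoeff q y l' j * balancedKernel q y C k j
      = if l = l' then qPoch q q l * qPoch (q * y / C) q l * C ^ l * qPochInf (C * q ^ l) q
          * (qPoch (y * q ^ l) q l * qPochInf (y * q ^ (2 * l + 1)) q) else 0 := by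
  rcases lt_trichotomy l l' with h | rfl | h
  · rw [if_neg h.ne, sum_sum_balancedKernel_of_lt hq hq1 hC y h]
  · rw [if_pos rfl, sum_sum_balancedKernel_self hq hq1 hC]
  · rw [if_neg h.ne', Finset.sum_comm, ← sum_sum_balancedKernel_of_lt hq hq1 hC y h]
    simp only [balancedKernel_comm hq1 y C, mul_comm (balancedCoeff q y l _)]

end Orthogonality

section Biorthogonality

variable {q : ℂ}

/-- The `k`-th basis function for the expansion of `biorthFun`, as a function of `m`. -/
noncomputable def biorthBasis (q y A B v : ℂ) (k m : ℕ) : ℂ :=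
  qPoch (v / B) q k * qPochInf (q * y / B * q ^ k) q
    * (qPoch ((q ^ k)⁻¹ * (q * A / v)) q m * (q ^ k) ^ m * qPochInf (v * q ^ (k + m)) q)

/-- The rational biorthogonal function
`₄φ₃(q⁻ˡ, yqˡ, v/A, v/B; q⁻ᵐv/A, vqᵐ, qy/B; q, q)` multiplied by
`(qA/v; q)_m (vqᵐ, qy/B; q)_∞`, which removes the poles in the lower parameters. -/
noncomputable def biorthFun (q y A B v : ℂ) (l m : ℕ) : ℂ :=
  ∑ k ∈ Finset.range (l + 1), balancedCoeff q y l k * biorthBasis q y A B v k m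

/-- The weight in `m` for which the functions `biorthFun q y A B v l` and
`biorthFun q y A B v' l'`, with `v v' = q² y A`, are biorthogonal. -/
noncomputable def biorthWeight (q y A B : ℂ) (m : ℕ) : ℂ :=
  (1 - A * q ^ (2 * m)) * (qPoch A q m * qPoch B q m / qPoch q q m)
    * qPochInf (q * A / B * q ^ m) q * (q * y / B) ^ m

/-- The squared norm of `biorthFun q y A B v l` with respect to `biorthWeight q y A B`, without the
factor `(A, v/B, v'/B; q)_∞` common to all `l`. -/
noncomputable def biorthNorm (q y B : ℂ) (l : ℕ) : ℂ :=
  qPoch q q l * qPoch B q l * (q * y / B) ^ l * qPochInf (q * y / B * q ^ l) q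
    * (qPoch (y * q ^ l) q l * qPochInf (y * q ^ (2 * l + 1)) q)

/-- The factor that makes `biorthFun q y A B v l m` symmetric under `(y, l) ↔ (A, m)`. -/
noncomputable def biorthScale (q A B v : ℂ) (m : ℕ) : ℂ :=
  (v / B) ^ m * qPoch B q m * qPochInf (q * A / B * q ^ m) q

/-- The weight in `l` of the relations dual to those for `biorthWeight`. -/
noncomputable def biorthDualWeight (q y B : ℂ) (l : ℕ) : ℂ :=
  (1 - y * q ^ (2 * l)) * qPoch y q l
    / (qPoch q q l * qPoch B q l * qPochInf (q * y / B * q ^ l) q) * (B / (q * y)) ^ l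

/-- The counterpart of `biorthNorm` for `biorthDualWeight`, without the factor
`(y, v/B, v'/B; q)_∞`. -/
noncomputable def biorthDualNorm (q y A B : ℂ) (m : ℕ) : ℂ :=
  qPoch q q m * (B / (q * y)) ^ m * (qPoch (A * q ^ m) q m * qPochInf (A * q ^ (2 * m + 1)) q)
    / (qPoch B q m * qPochInf (q * A / B * q ^ m) q)

theorem biorthScale_mul_biorthFun_eq_sum_sum {B v : ℂ} (hq : q ≠ 0) (hq1 : ‖q‖ < 1)
    (hB : B ≠ 0) (hv : v ≠ 0) (y A : ℂ) (l m : ℕ) :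
    biorthScale q A B v m * biorthFun q y A B v l m
      = ∑ k ∈ Finset.range (l + 1), ∑ j ∈ Finset.range (m + 1),
        balancedCoeff q y l k * balancedCoeff q A m j * (qPoch (v / B) q (k + j)
          * (qPochInf (q * y / B * q ^ k) q * qPochInf (q * A / B * q ^ j) q)
          * qPochInf (v * q ^ (k + j)) q) := by
  rw [biorthFun, biorthScale, Finset.mul_sum]
  refine Finset.sum_congr rfl fun k _ => ?_
  have hk := pow_ne_zero k hq
  have hterm : ∀ j, balancedCoeff q y l k * balancedCoeff q A m j * (qPoch (v / B) q (k + j)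
      * (qPochInf (q * y / B * q ^ k) q * qPochInf (q * A / B * q ^ j) q)
      * qPochInf (v * q ^ (k + j)) q)
      = balancedCoeff q y l k * qPoch (v / B) q k * qPochInf (q * y / B * q ^ k) q
        * saalschutzTerm q A (v / B * q ^ k) (q * A / B) (v * q ^ k) m j := fun j => by
    rw [qPoch_add, saalschutzTerm, pow_add, mul_assoc v]
    ring
  simp only [hterm, ← Finset.mul_sum]
  rw [sum_saalschutzTerm hq hq1 (mul_ne_zero (div_ne_zero hv hB) hk) (by ring), biorthBasis,
    show q * A / B / (v / B * q ^ k) = (q ^ k)⁻¹ * (q * A / v) by field_simp,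
    show v * q ^ k / (v / B * q ^ k) = B by field_simp, mul_assoc v, ← pow_add]
  ring

theorem biorthFun_duality {B v : ℂ} (hq : q ≠ 0) (hq1 : ‖q‖ < 1) (hB : B ≠ 0) (hv : v ≠ 0)
    (y A : ℂ) (l m : ℕ) :
    biorthScale q A B v m * biorthFun q y A B v l m
      = biorthScale q y B v l * biorthFun q A y B v m l := by
  rw [biorthScale_mul_biorthFun_eq_sum_sum hq hq1 hB hv,
    biorthScale_mul_biorthFun_eq_sum_sum hq hq1 hB hv, Finset.sum_comm]
  simp only [add_comm, mul_comm]

theorem div_pow_mul_div_pow_mul_div_pow {y A B v v' : ℂ} (hq : q ≠ 0) (hy : y ≠ 0) (hB : B ≠ 0)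
    (hvv : v * v' = q ^ 2 * y * A) (n : ℕ) :
    (v / B) ^ n * (v' / B) ^ n * (B / (q * y)) ^ n = (q * A / B) ^ n := by
  rw [← mul_pow, ← mul_pow]
  congr 1
  field_simp
  linear_combination hvv

theorem biorthScale_ne_zero {A B v : ℂ} (hq1 : ‖q‖ < 1) (hB0 : B ≠ 0) (hB : B ∉ qOmega q)
    (hv : v ≠ 0) (hAB : q * A / B ∉ qOmega q) (m : ℕ) : biorthScale q A B v m ≠ 0 :=
  mul_ne_zero (mul_ne_zero (pow_ne_zero m (div_ne_zero hv hB0)) (qPoch_ne_zero hB m))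
    (qPochInf_mul_pow_ne_zero hq1 hAB m)

theorem biorthDualWeight_mul_biorthScale {y A B v v' : ℂ} (hq : q ≠ 0) (hq1 : ‖q‖ < 1)
    (hy : y ≠ 0) (hB0 : B ≠ 0) (hB : B ∉ qOmega q) (hyB : q * y / B ∉ qOmega q)
    (hvv : v * v' = q ^ 2 * y * A) (l : ℕ) :
    biorthDualWeight q y B l * (biorthScale q y B v l * biorthScale q y B v' l)
      = biorthWeight q A y B l := by
  have hB_ne := qPoch_ne_zero hB l
  have hyB_ne := qPochInf_mul_pow_ne_zero hq1 hyB l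
  have hpow := div_pow_mul_div_pow_mul_div_pow hq hy hB0 hvv l
  simp only [biorthDualWeight, biorthScale, biorthWeight, ← hpow]
  generalize qPochInf (q * y / B * q ^ l) q = P at hyB_ne ⊢
  generalize (v / B) ^ l = V, (v' / B) ^ l = V', (B / (q * y)) ^ l = Z
  field_simp

theorem biorthDualNorm_mul_biorthScale {y A B v v' : ℂ} (hq : q ≠ 0) (hq1 : ‖q‖ < 1)
    (hy : y ≠ 0) (hB0 : B ≠ 0) (hB : B ∉ qOmega q) (hAB : q * A / B ∉ qOmega q)
    (hvv : v * v' = q ^ 2 * y * A) (m : ℕ) :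
    biorthDualNorm q y A B m * (biorthScale q A B v m * biorthScale q A B v' m)
      = biorthNorm q A B m := by
  have hB_ne := qPoch_ne_zero hB m
  have hAB_ne := qPochInf_mul_pow_ne_zero hq1 hAB m
  have hpow := div_pow_mul_div_pow_mul_div_pow hq hy hB0 hvv m
  simp only [biorthDualNorm, biorthScale, biorthNorm, ← hpow]
  generalize qPochInf (q * A / B * q ^ m) q = P at hAB_ne ⊢
  generalize (v / B) ^ m = V, (v' / B) ^ m = V', (B / (q * y)) ^ m = Z
  field_simp

theorem hasSum_biorthWeight_mul_biorthBasis {y A B v v' : ℂ} (hq : q ≠ 0) (hq1 : ‖q‖ < 1)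
    (hA : A ≠ 0) (hB : B ≠ 0) (hv : v ≠ 0) (hv' : v' ≠ 0) (hvv : v * v' = q ^ 2 * y * A)
    (hC : ‖q * y / B‖ < 1) (k j : ℕ) :
    HasSum (fun m => biorthWeight q y A B m
        * (biorthBasis q y A B v k m * biorthBasis q y A B v' j m))
      (qPochInf A q * qPochInf (v / B) q * qPochInf (v' / B) q
        * balancedKernel q y (q * y / B) k j) := by
  have hqk := pow_ne_zero k hq
  have hqj := pow_ne_zero j hq
  have hC' : ‖q * y / B * q ^ (k + j)‖ < 1 := by
    rw [norm_mul, norm_pow]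
    exact mul_lt_one_of_nonneg_of_lt_one_left (norm_nonneg _) hC
      (pow_le_one₀ (norm_nonneg q) hq1.le)
  have hCX : ∀ {w : ℂ}, w ≠ 0 → ∀ i, A * q / ((q ^ i)⁻¹ * (q * A / w)) = w * q ^ i :=
    fun {w} hw i => by field_simp
  have hBCX : ∀ {w : ℂ}, w ≠ 0 → ∀ i, A * q / (B * ((q ^ i)⁻¹ * (q * A / w))) = w / B * q ^ i :=
    fun {w} hw i => by field_simp
  have hXX : A * q / ((q ^ k)⁻¹ * (q * A / v) * ((q ^ j)⁻¹ * (q * A / v')))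
      = q * y * q ^ (k + j) := by
    rw [pow_add]
    field_simp
    linear_combination hvv
  have hz : A * q / (B * ((q ^ k)⁻¹ * (q * A / v)) * ((q ^ j)⁻¹ * (q * A / v')))
      = q * y / B * q ^ (k + j) := by
    rw [mul_assoc B, mul_comm B, ← div_div, hXX]
    ring
  have hsum := hasSum_wellPoised (A := A) hq hq1 hB (C := (q ^ k)⁻¹ * (q * A / v))
    (D := (q ^ j)⁻¹ * (q * A / v')) (by simp [hq, hA, hv]) (by simp [hq, hA, hv']) (by rwa [hz])
  rw [hz, hXX, hBCX hv, hBCX hv'] at hsum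
  have hkernel : qPochInf A q * qPochInf (v / B) q * qPochInf (v' / B) q
      * balancedKernel q y (q * y / B) k j
      = qPoch (v / B) q k * qPoch (v' / B) q j
        * (qPochInf (q * y / B * q ^ k) q * qPochInf (q * y / B * q ^ j) q)
        * (qPochInf A q * (qPochInf (v / B * q ^ k) q * qPochInf (v' / B * q ^ j) q
          * qPochInf (q * y * q ^ (k + j)) q) / qPochInf (q * y / B * q ^ (k + j)) q) := by
    have hne := qPochInf_ne_zero hq1 (notMem_qOmega_of_norm_lt_one hq hq1 hC')
    rw [balancedKernel, ← qPoch_mul_qPochInf hq1 (v / B) k, ← qPoch_mul_qPochInf hq1 (v' / B) j,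
      ← qPoch_mul_qPochInf hq1 (q * y / B * q ^ k) j, mul_assoc (q * y / B), ← pow_add]
    generalize qPochInf (q * y / B * q ^ (k + j)) q = P at hne ⊢
    field_simp
  rw [hkernel]
  refine (hsum.mul_left _).congr_fun fun m => ?_
  rw [wellPoisedTerm, hz, hCX hv, hCX hv', biorthWeight, biorthBasis, biorthBasis,
    mul_pow (q * y / B), pow_add q k j, mul_pow (q ^ k), mul_assoc v, mul_assoc v', ← pow_add,
    ← pow_add, mul_comm A q]
  ring

theorem hasSum_biorthWeight_mul_biorthFun {y A B v v' : ℂ} (hq : q ≠ 0) (hq1 : ‖q‖ < 1)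
    (hy : y ≠ 0) (hA : A ≠ 0) (hB : B ≠ 0) (hv : v ≠ 0) (hv' : v' ≠ 0)
    (hvv : v * v' = q ^ 2 * y * A) (hC : ‖q * y / B‖ < 1) (l l' : ℕ) :
    HasSum (fun m => biorthWeight q y A B m
        * (biorthFun q y A B v l m * biorthFun q y A B v' l' m))
      (qPochInf A q * qPochInf (v / B) q * qPochInf (v' / B) q
        * if l = l' then biorthNorm q y B l else 0) := by
  have hC0 : q * y / B ≠ 0 := div_ne_zero (mul_ne_zero hq hy) hB
  have hsum := hasSum_sum fun k (_ : k ∈ Finset.range (l + 1)) =>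
    hasSum_sum fun j (_ : j ∈ Finset.range (l' + 1)) =>
      (hasSum_biorthWeight_mul_biorthBasis hq hq1 hA hB hv hv' hvv hC k j).mul_left
        (balancedCoeff q y l k * balancedCoeff q y l' j)
  have hnorm := sum_sum_balancedKernel hq hq1 hC0 y l l'
  rw [show q * y / (q * y / B) = B by field_simp] at hnorm
  simp only [mul_left_comm (balancedCoeff q y l _ * _), ← Finset.mul_sum, hnorm] at hsum
  refine hsum.congr_fun fun m => ?_
  rw [biorthFun, biorthFun, Finset.sum_mul]
  congr 1
  refine Finset.sum_congr rfl fun k _ => ?_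
  simp only [Finset.mul_sum]
  refine Finset.sum_congr rfl fun j _ => ?_
  ring

theorem hasSum_biorthDualWeight_mul_biorthFun {y A B v v' : ℂ} (hq : q ≠ 0) (hq1 : ‖q‖ < 1)
    (hy : y ≠ 0) (hA : A ≠ 0) (hB0 : B ≠ 0) (hB : B ∉ qOmega q) (hv : v ≠ 0) (hv' : v' ≠ 0)
    (hvv : v * v' = q ^ 2 * y * A) (hAB : ‖q * A / B‖ < 1) (hyB : q * y / B ∉ qOmega q)
    (m m' : ℕ) :
    HasSum (fun l => biorthDualWeight q y B l
        * (biorthFun q y A B v l m * biorthFun q y A B v' l m'))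
      (qPochInf y q * qPochInf (v / B) q * qPochInf (v' / B) q
        * if m = m' then biorthDualNorm q y A B m else 0) := by
  have hAB' := notMem_qOmega_of_norm_lt_one hq hq1 hAB
  have hne : biorthScale q A B v m * biorthScale q A B v' m' ≠ 0 :=
    mul_ne_zero (biorthScale_ne_zero hq1 hB0 hB hv hAB' m)
      (biorthScale_ne_zero hq1 hB0 hB hv' hAB' m')
  rw [← hasSum_mul_right_iff hne]
  have hsum := hasSum_biorthWeight_mul_biorthFun hq hq1 hA hy hB0 hv hv' (by rw [hvv]; ring) hAB
    m m'
  have hnorm : (if m = m' then biorthDualNorm q y A B m else 0)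
      * (biorthScale q A B v m * biorthScale q A B v' m')
      = if m = m' then biorthNorm q A B m else 0 := by
    split_ifs with hmm
    · rw [← hmm, biorthDualNorm_mul_biorthScale hq hq1 hy hB0 hB hAB' hvv]
    · rw [zero_mul]
  rw [mul_assoc _ (ite _ _ _), hnorm]
  refine hsum.congr_fun fun l => ?_
  rw [← biorthDualWeight_mul_biorthScale hq hq1 hy hB0 hB hyB hvv]
  linear_combination biorthDualWeight q y B l
    * (biorthScale q A B v' m' * biorthFun q y A B v' l m'
        * biorthFun_duality hq hq1 hB0 hv y A l m
      + biorthScale q y B v l * biorthFun q A y B v m l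
        * biorthFun_duality hq hq1 hB0 hv' y A l m')

end Biorthogonality

section RationalPhi

variable {q : ℂ}

theorem rationalPhi_eq_sum (hq : q ≠ 0) (t a b c d : ℂ) (l m : ℕ) :
    rationalPhi q t a b c d l m = ∑ k ∈ Finset.range (l + 1), balancedCoeff q (1 / c ^ 2) l k
      * (qPoch (q * (a * t / c)) q k * qPoch (q * b * t / c) q k
        / (qPoch (q ^ (1 - (m : ℤ)) * (a * t / c)) q k * qPoch (q * t / (a * c) * q ^ m) q k
          * qPoch (q * d / c) q k)) := by
  have hl : q ^ (-(l : ℤ)) = (q ^ l)⁻¹ := by rw [zpow_neg, zpow_natCast]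
  rw [rationalPhi, basicHyp, tsum_eq_sum (s := Finset.range (l + 1))]
  · refine Finset.sum_congr rfl fun k _ => ?_
    simp only [qPochs, List.map_cons, List.map_nil, List.prod_cons, List.prod_nil, mul_one,
      List.length_cons, List.length_nil, hl, balancedCoeff]
    rw [show (1 + ((0 + 1 + 1 + 1 : ℕ) : ℤ) - ((0 + 1 + 1 + 1 + 1 : ℕ) : ℤ)) = 0 by norm_num,
      zpow_zero, mul_one, show q * a * t / c = q * (a * t / c) by ring,
      show q ^ (1 - (m : ℤ)) * a * t / c = q ^ (1 - (m : ℤ)) * (a * t / c) by ring,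
      show q ^ (m + 1) * t / (a * c) = q * t / (a * c) * q ^ m by ring,
      show q ^ l / c ^ 2 = q ^ l * (1 / c ^ 2) by ring]
    simp only [div_eq_mul_inv, mul_inv]
    ring
  · intro k hk
    have : l < k := by simpa using hk
    simp only [qPochs, List.map_cons, List.prod_cons, hl, qPoch_inv_pow_eq_zero hq this, zero_mul,
      zero_div]

theorem qPoch_reverse {x : ℂ} (hq : q ≠ 0) (hx : x ≠ 0) (m : ℕ) :
    qPoch (q ^ (1 - (m : ℤ)) * x) q m * q ^ m.choose 2 = qPoch x⁻¹ q m * (-x) ^ m := by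
  induction m with
  | zero => simp [qPoch_zero]
  | succ m ih =>
    have hfirst : q ^ (1 - ((m + 1 : ℕ) : ℤ)) * x = (q ^ m)⁻¹ * x := by
      rw [Nat.cast_add_one, sub_add_cancel_right, zpow_neg, zpow_natCast]
    have hsecond : (q ^ m)⁻¹ * x * q = q ^ (1 - (m : ℤ)) * x := by
      rw [zpow_sub₀ hq, zpow_one, zpow_natCast]
      ring
    have hfactor : (1 - (q ^ m)⁻¹ * x) * q ^ m = (1 - x⁻¹ * q ^ m) * -x := by
      have := pow_ne_zero m hq
      field_simp
      ring
    rw [hfirst, qPoch_succ_left, hsecond, Nat.choose_succ_succ' m 1, Nat.choose_one_right,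
      qPoch_succ]
    linear_combination (qPoch (q ^ (1 - (m : ℤ)) * x) q m * q ^ m.choose 2) * hfactor
      + (1 - x⁻¹ * q ^ m) * -x * ih

theorem qPoch_mul_qPoch_inv {x : ℂ} (hq : q ≠ 0) (hx : x ≠ 0) (k m : ℕ) :
    qPoch (q * x) q k * qPoch x⁻¹ q m = qPoch (q ^ (1 - (m : ℤ)) * x) q k
      * (qPoch ((q ^ k)⁻¹ * x⁻¹) q m * (q ^ k) ^ m) := by
  have hqk := pow_ne_zero k hq
  have hsplit := (qPoch_add (q ^ (1 - (m : ℤ)) * x) q m k).symm.trans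
    (add_comm m k ▸ qPoch_add (q ^ (1 - (m : ℤ)) * x) q k m)
  have hshift : q ^ (1 - (m : ℤ)) * x * q ^ m = q * x := by
    rw [zpow_sub₀ hq, zpow_one, zpow_natCast]
    field_simp
  rw [hshift, mul_assoc _ x, mul_comm x] at hsplit
  have hrev := qPoch_reverse hq hx m
  have hrev' := qPoch_reverse hq (mul_ne_zero hqk hx) m
  rw [mul_inv, ← mul_neg, mul_pow] at hrev'
  refine mul_right_cancel₀ (pow_ne_zero m (neg_ne_zero.mpr hx)) ?_
  linear_combination q ^ m.choose 2 * hsplit - qPoch (q * x) q k * hrev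
    + qPoch (q ^ (1 - (m : ℤ)) * x) q k * hrev'

theorem qPoch_inv_ne_zero {x : ℂ} (hq : q ≠ 0) (hx : x ≠ 0) {m : ℕ}
    (h : q ^ (1 - (m : ℤ)) * x ∉ qOmega q) : qPoch x⁻¹ q m ≠ 0 :=
  left_ne_zero_of_mul <| qPoch_reverse hq hx m ▸
    mul_ne_zero (qPoch_ne_zero h m) (pow_ne_zero _ hq)

theorem mul_one_div_sq_div_one_div {a b x : ℂ} (ha : a ≠ 0) (hx : x = a * b) :
    q * (1 / a ^ 2) / (1 / x) = q * b / a := by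
  rw [hx, div_div_eq_mul_div, div_one]
  field_simp

theorem rationalPhi_mul_eq_biorthFun {t a b c d : ℂ} (hq : q ≠ 0) (hq1 : ‖q‖ < 1) (ht : t ≠ 0)
    (ha : a ≠ 0) (hb : b ≠ 0) (hc : c ≠ 0) (habcd : a * b = c * d)
    (hv : q * t / (a * c) ∉ qOmega q) (hdc : q * d / c ∉ qOmega q) {m : ℕ}
    (hm : q ^ (1 - (m : ℤ)) * a * t / c ∉ qOmega q) (l : ℕ) :
    rationalPhi q t a b c d l m
        * (qPoch (c / (a * t)) q m * qPochInf (q * t / (a * c) * q ^ m) q * qPochInf (q * d / c) q)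
      = biorthFun q (1 / c ^ 2) (1 / a ^ 2) (1 / (a * b)) (q * t / (a * c)) l m := by
  have hC : q * (1 / c ^ 2) / (1 / (a * b)) = q * d / c := mul_one_div_sq_div_one_div hc habcd
  have hX : q * (1 / a ^ 2) / (q * t / (a * c)) = (a * t / c)⁻¹ := by field_simp
  have hvB : q * t / (a * c) / (1 / (a * b)) = q * b * t / c := by field_simp
  have hx : a * t / c ≠ 0 := div_ne_zero (mul_ne_zero ha ht) hc
  rw [rationalPhi_eq_sum hq, biorthFun, Finset.sum_mul]
  refine Finset.sum_congr rfl fun k _ => ?_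
  have hw := mul_inv_cancel₀ (qPoch_ne_zero (show q ^ (1 - (m : ℤ)) * (a * t / c) ∉ qOmega q by
    rwa [← mul_div_assoc, ← mul_assoc]) k)
  have hvm := qPochInf_mul_pow_ne_zero hq1 hv m
  have hdck := mul_inv_cancel₀ (qPoch_ne_zero hdc k)
  have hflip := qPoch_mul_qPoch_inv hq hx k m
  rw [← qPoch_mul_qPochInf hq1 _ k] at hvm
  replace hvm := mul_inv_cancel₀ (left_ne_zero_of_mul hvm)
  rw [biorthBasis, hC, hX, hvB, ← inv_div (a * t) c, ← qPoch_mul_qPochInf hq1 (q * d / c) k,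
    ← qPoch_mul_qPochInf hq1 (q * t / (a * c) * q ^ m) k, mul_assoc (q * t / (a * c)), ← pow_add,
    add_comm m k]
  generalize q * t / (a * c) = v at hvm ⊢
  generalize q ^ (1 - (m : ℤ)) * (a * t / c) = w at hw hflip ⊢
  generalize q * d / c = C at hdck ⊢
  generalize a * t / c = x at hflip ⊢
  linear_combination (balancedCoeff q (1 / c ^ 2) l k * qPoch (q * b * t / c) q k
      * qPochInf (v * q ^ (k + m)) q * qPochInf (C * q ^ k) q)
    * (qPoch (q * x) q k * qPoch x⁻¹ q m * (qPoch w q k)⁻¹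
        * (qPoch C q k * (qPoch C q k)⁻¹ * hvm + hdck)
      + (qPoch w q k)⁻¹ * hflip + qPoch ((q ^ k)⁻¹ * x⁻¹) q m * (q ^ k) ^ m * hw)

theorem one_sub_one_div_sq_mul_ne_zero {c x : ℂ} (hc : c ≠ 0) (hx : c ^ 2 ≠ x) :
    1 - 1 / c ^ 2 * x ≠ 0 := fun h => hx <| by
  field_simp at h
  linear_combination h

theorem qPoch_one_div_sq_ne_zero {c : ℂ} (hc : c ≠ 0) {l : ℕ} (hl : ∀ k < l, c ^ 2 ≠ q ^ k) :
    qPoch (1 / c ^ 2) q l ≠ 0 :=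
  Finset.prod_ne_zero_iff.mpr fun k hk =>
    one_sub_one_div_sq_mul_ne_zero hc (hl k (Finset.mem_range.mp hk))

end RationalPhi

section Normalization

variable {q : ℂ}

/-- The series `₄φ₃(q⁻ˡ, yqˡ, v/A, v/B; q⁻ᵐv/A, vqᵐ, qy/B; q, q)` itself, recovered from
`biorthFun` by restoring the poles. -/
noncomputable def biorthPhi (q y A B v : ℂ) (l m : ℕ) : ℂ :=
  biorthFun q y A B v l m
    / (qPoch (q * A / v) q m * qPochInf (v * q ^ m) q * qPochInf (q * y / B) q)

/-- The constant `bioConst` in the parameters of `biorthPhi`. -/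
noncomputable def biorthConst (q y A B v v' : ℂ) : ℂ :=
  qPochInf (q * A) q * qPochInf (q * y) q * qPochInf (v / B) q * qPochInf (v' / B) q
    / (qPochInf (q * A / B) q * qPochInf (q * y / B) q * qPochInf v q * qPochInf v' q)

theorem biorthPhi_mul {y A B v : ℂ} {m : ℕ} (hq1 : ‖q‖ < 1) (hX : qPoch (q * A / v) q m ≠ 0)
    (hv : v ∉ qOmega q) (hC : q * y / B ∉ qOmega q) (l : ℕ) :
    biorthPhi q y A B v l m
        * (qPoch (q * A / v) q m * qPochInf (v * q ^ m) q * qPochInf (q * y / B) q)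
      = biorthFun q y A B v l m :=
  div_mul_cancel₀ _ (mul_ne_zero (mul_ne_zero hX (qPochInf_mul_pow_ne_zero hq1 hv m))
    (qPochInf_ne_zero hq1 hC))

theorem qPochInf_eq_mul_qPoch_two_mul (hq1 : ‖q‖ < 1) (x : ℂ) (n : ℕ) :
    qPochInf x q = (1 - x * q ^ (2 * n)) * qPoch x q n
      * (qPoch (x * q ^ n) q n * qPochInf (x * q ^ (2 * n + 1)) q) := by
  rw [← qPoch_mul_qPochInf hq1 x (2 * n), qPochInf_mul_pow hq1 x (2 * n), two_mul, qPoch_add]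
  ring

theorem biorthNorm_eq {y B : ℂ} {l : ℕ} (hq1 : ‖q‖ < 1) (hC : q * y / B ∉ qOmega q)
    (hy : qPoch y q l ≠ 0) (hyl : 1 - y * q ^ (2 * l) ≠ 0) :
    biorthNorm q y B l = (q * y / B) ^ l * ((1 - y) / (1 - y * q ^ (2 * l)))
      * (qPoch q q l * qPoch B q l / (qPoch y q l * qPoch (q * y / B) q l))
      * (qPochInf (q * y / B) q * qPochInf (q * y) q) := by
  have hCl := qPoch_ne_zero hC l
  have hsplit := qPochInf_eq_mul_qPoch_two_mul hq1 y l
  rw [← one_sub_mul_qPochInf hq1, mul_comm y] at hsplit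
  rw [biorthNorm, ← qPoch_mul_qPochInf hq1 (q * y / B) l]
  generalize qPoch (q * y / B) q l = C at hCl ⊢
  generalize (q * y / B) ^ l = Z, qPochInf (q * y / B * q ^ l) q = P
  generalize qPochInf (q * y) q = Q at hsplit ⊢
  generalize qPoch y q l = Y, 1 - y * q ^ (2 * l) = W at *
  field_simp
  linear_combination -(qPoch q q l * qPoch B q l * Z * P) * hsplit

theorem biorthWeight_mul_biorthFun_eq {y A B v v' : ℂ} {m : ℕ} (hq1 : ‖q‖ < 1)
    (hA1 : 1 - A ≠ 0) (hC : q * y / B ∉ qOmega q) (hAB : q * A / B ∉ qOmega q)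
    (hv : v ∉ qOmega q) (hv' : v' ∉ qOmega q) (hX : qPoch (q * A / v) q m ≠ 0)
    (hX' : qPoch (q * A / v') q m ≠ 0) (l l' : ℕ) :
    biorthWeight q y A B m * (biorthFun q y A B v l m * biorthFun q y A B v' l' m)
      = (1 - A) * qPochInf (q * A / B) q * qPochInf v q * qPochInf v' q
          * qPochInf (q * y / B) q ^ 2
        * ((1 - A * q ^ (2 * m)) / (1 - A)
          * (qPoch A q m * qPoch B q m * qPoch (q * A / v') q m * qPoch (q * A / v) q m
            / (qPoch q q m * qPoch (q * A / B) q m * qPoch v q m * qPoch v' q m))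
          * (q * y / B) ^ m * biorthPhi q y A B v l m * biorthPhi q y A B v' l' m) := by
  have hcancel : (1 - A) * qPoch (q * A / B) q m * qPoch v q m * qPoch v' q m
      * ((1 - A) * qPoch (q * A / B) q m * qPoch v q m * qPoch v' q m)⁻¹ = 1 :=
    mul_inv_cancel₀ (mul_ne_zero (mul_ne_zero (mul_ne_zero hA1 (qPoch_ne_zero hAB m))
      (qPoch_ne_zero hv m)) (qPoch_ne_zero hv' m))
  rw [← biorthPhi_mul hq1 hX hv hC, ← biorthPhi_mul hq1 hX' hv' hC, biorthWeight,
    ← qPoch_mul_qPochInf hq1 (q * A / B) m, ← qPoch_mul_qPochInf hq1 v m,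
    ← qPoch_mul_qPochInf hq1 v' m]
  generalize qPochInf (q * A / B * q ^ m) q = D', qPoch (q * A / B) q m = D,
    qPochInf (q * y / B) q = C, (q * y / B) ^ m = Z, qPochInf (v * q ^ m) q = U,
    qPochInf (v' * q ^ m) q = U', 1 - A = A₁ at hcancel ⊢
  linear_combination (-((1 - A * q ^ (2 * m)) * (qPoch A q m * qPoch B q m / qPoch q q m)
    * D' * Z * (biorthPhi q y A B v l m * (qPoch (q * A / v) q m * U * C))
    * (biorthPhi q y A B v' l' m * (qPoch (q * A / v') q m * U' * C)))) * hcancel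

theorem hasSum_biorthPhi_argument {y A B v v' : ℂ} (hq : q ≠ 0) (hq1 : ‖q‖ < 1)
    (hy : y ≠ 0) (hA : A ≠ 0) (hA1 : 1 - A ≠ 0) (hB : B ≠ 0) (hv0 : v ≠ 0) (hv0' : v' ≠ 0)
    (hvv : v * v' = q ^ 2 * y * A) (hC : ‖q * y / B‖ < 1) (hAB : q * A / B ∉ qOmega q)
    (hv : v ∉ qOmega q) (hv' : v' ∉ qOmega q) (hX : ∀ m, qPoch (q * A / v) q m ≠ 0)
    (hX' : ∀ m, qPoch (q * A / v') q m ≠ 0) {l : ℕ} (hyl : qPoch y q l ≠ 0)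
    (hyl2 : 1 - y * q ^ (2 * l) ≠ 0) (l' : ℕ) :
    HasSum
      (fun m => (1 - A * q ^ (2 * m)) / (1 - A)
        * (qPoch A q m * qPoch B q m * qPoch (q * A / v') q m * qPoch (q * A / v) q m
          / (qPoch q q m * qPoch (q * A / B) q m * qPoch v q m * qPoch v' q m))
        * (q * y / B) ^ m * biorthPhi q y A B v l m * biorthPhi q y A B v' l' m)
      (biorthConst q y A B v v' * (q * y / B) ^ l * ((1 - y) / (1 - y * q ^ (2 * l)))
        * (qPoch q q l * qPoch B q l / (qPoch y q l * qPoch (q * y / B) q l))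
        * if l = l' then 1 else 0) := by
  have hC' := notMem_qOmega_of_norm_lt_one hq hq1 hC
  have hC_ne := qPochInf_ne_zero hq1 hC'
  have hAB_ne := qPochInf_ne_zero hq1 hAB
  have hv_ne := qPochInf_ne_zero hq1 hv
  have hv_ne' := qPochInf_ne_zero hq1 hv'
  set κ := (1 - A) * qPochInf (q * A / B) q * qPochInf v q * qPochInf v' q
    * qPochInf (q * y / B) q ^ 2 with hκ
  have hκ0 : κ ≠ 0 := by simp [hκ, hA1, hC_ne, hAB_ne, hv_ne, hv_ne']
  have hsum := hasSum_biorthWeight_mul_biorthFun hq hq1 hy hA hB hv0 hv0' hvv hC l l'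
  rw [← hasSum_mul_left_iff hκ0]
  have hvalue : qPochInf A q * qPochInf (v / B) q * qPochInf (v' / B) q
      * (qPochInf (q * y / B) q * qPochInf (q * y) q) = κ * biorthConst q y A B v v' := by
    rw [hκ, biorthConst, ← one_sub_mul_qPochInf hq1 A, mul_comm A]
    generalize qPochInf (q * A / B) q = P at hAB_ne ⊢
    generalize qPochInf (q * y / B) q = P' at hC_ne ⊢
    field_simp
  have hnorm : κ * (biorthConst q y A B v v' * (q * y / B) ^ l
        * ((1 - y) / (1 - y * q ^ (2 * l)))
        * (qPoch q q l * qPoch B q l / (qPoch y q l * qPoch (q * y / B) q l))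
        * if l = l' then 1 else 0)
      = qPochInf A q * qPochInf (v / B) q * qPochInf (v' / B) q
        * if l = l' then biorthNorm q y B l else 0 := by
    split_ifs
    · rw [biorthNorm_eq hq1 hC' hyl hyl2]
      linear_combination (-(q * y / B) ^ l * ((1 - y) / (1 - y * q ^ (2 * l)))
        * (qPoch q q l * qPoch B q l / (qPoch y q l * qPoch (q * y / B) q l))) * hvalue
    · ring
  rw [hnorm]
  exact hsum.congr_fun fun m =>
    (biorthWeight_mul_biorthFun_eq hq1 hA1 hC' hAB hv hv' (hX m) (hX' m) l l').symm

theorem biorthDualNorm_eq {y A B : ℂ} {m : ℕ} (hq1 : ‖q‖ < 1) (hAB : q * A / B ∉ qOmega q)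
    (hA : qPoch A q m ≠ 0) (hAm : 1 - A * q ^ (2 * m) ≠ 0) :
    biorthDualNorm q y A B m = (B / (q * y)) ^ m * ((1 - A) / (1 - A * q ^ (2 * m)))
      * (qPoch q q m * qPoch (q * A / B) q m / (qPoch A q m * qPoch B q m))
      * (qPochInf (q * A) q / qPochInf (q * A / B) q) := by
  have hD := qPoch_ne_zero hAB m
  have hsplit := qPochInf_eq_mul_qPoch_two_mul hq1 A m
  rw [← one_sub_mul_qPochInf hq1, mul_comm A] at hsplit
  have hratio : qPoch (A * q ^ m) q m * qPochInf (A * q ^ (2 * m + 1)) q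
      = (1 - A) * qPochInf (q * A) q / ((1 - A * q ^ (2 * m)) * qPoch A q m) := by
    rw [eq_div_iff (mul_ne_zero hAm hA), hsplit]
    ring
  rw [biorthDualNorm, hratio, ← qPoch_mul_qPochInf hq1 (q * A / B) m]
  generalize qPoch (q * A / B) q m = D at hD ⊢
  field_simp

theorem biorthDualWeight_mul_biorthFun_eq {y A B v v' : ℂ} {m m' : ℕ} (hq1 : ‖q‖ < 1)
    (hy1 : 1 - y ≠ 0) (hC : q * y / B ∉ qOmega q) (hv : v ∉ qOmega q) (hv' : v' ∉ qOmega q)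
    (hX : qPoch (q * A / v) q m ≠ 0) (hX' : qPoch (q * A / v') q m' ≠ 0) (l : ℕ) :
    biorthDualWeight q y B l * (biorthFun q y A B v l m * biorthFun q y A B v' l m')
      = (1 - y) * qPochInf (q * y / B) q * (qPoch (q * A / v) q m * qPochInf (v * q ^ m) q)
          * (qPoch (q * A / v') q m' * qPochInf (v' * q ^ m') q)
        * ((1 - y * q ^ (2 * l)) / (1 - y)
          * (qPoch (q * y / B) q l * qPoch y q l / (qPoch q q l * qPoch B q l))
          * (B / (q * y)) ^ l * biorthPhi q y A B v l m * biorthPhi q y A B v' l m') := by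
  have hy_cancel := mul_inv_cancel₀ hy1
  have hC_cancel := mul_inv_cancel₀ (qPochInf_mul_pow_ne_zero hq1 hC l)
  rw [← biorthPhi_mul hq1 hX hv hC, ← biorthPhi_mul hq1 hX' hv' hC, biorthDualWeight,
    ← qPoch_mul_qPochInf hq1 (q * y / B) l]
  generalize qPochInf (q * y / B * q ^ l) q = P, qPoch (q * y / B) q l = C,
    (B / (q * y)) ^ l = Z, 1 - y = y₁ at hy_cancel hC_cancel ⊢
  linear_combination ((1 - y * q ^ (2 * l)) * (qPoch y q l * C / (qPoch q q l * qPoch B q l)) * Z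
    * (biorthPhi q y A B v l m * (qPoch (q * A / v) q m * qPochInf (v * q ^ m) q))
    * (biorthPhi q y A B v' l m' * (qPoch (q * A / v') q m' * qPochInf (v' * q ^ m') q)) * (C * P))
    * (hC_cancel - hy_cancel)

theorem mul_biorthConst_mul_qPoch {y A B v v' : ℂ} (hq1 : ‖q‖ < 1) (hC : q * y / B ∉ qOmega q)
    (hv : v ∉ qOmega q) (hv' : v' ∉ qOmega q) (m : ℕ) :
    (1 - y) * qPochInf (q * y / B) q * qPochInf (v * q ^ m) q * qPochInf (v' * q ^ m) q
        * biorthConst q y A B v v' * (qPoch v q m * qPoch v' q m)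
      = qPochInf y q * qPochInf (v / B) q * qPochInf (v' / B) q
        * (qPochInf (q * A) q / qPochInf (q * A / B) q) := by
  have hC_ne := qPochInf_ne_zero hq1 hC
  have hv_ne := qPochInf_ne_zero hq1 hv
  have hv_ne' := qPochInf_ne_zero hq1 hv'
  rw [biorthConst, ← one_sub_mul_qPochInf hq1 y, mul_comm y]
  have hvm := qPoch_mul_qPochInf hq1 v m
  have hvm' := qPoch_mul_qPochInf hq1 v' m
  generalize qPochInf v q = U, qPochInf (v * q ^ m) q = P at hv_ne hvm ⊢
  generalize qPochInf v' q = U', qPochInf (v' * q ^ m) q = P' at hv_ne' hvm' ⊢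
  generalize qPochInf (q * y / B) q = C at hC_ne ⊢
  field_simp
  rw [← hvm, ← hvm']
  ring

theorem hasSum_biorthPhi_degree {y A B v v' : ℂ} {m m' : ℕ} (hq : q ≠ 0) (hq1 : ‖q‖ < 1)
    (hy : y ≠ 0) (hy1 : 1 - y ≠ 0) (hA : A ≠ 0) (hB0 : B ≠ 0) (hB : B ∉ qOmega q)
    (hv0 : v ≠ 0) (hv0' : v' ≠ 0) (hvv : v * v' = q ^ 2 * y * A) (hAB : ‖q * A / B‖ < 1)
    (hC : q * y / B ∉ qOmega q) (hv : v ∉ qOmega q) (hv' : v' ∉ qOmega q)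
    (hX : qPoch (q * A / v) q m ≠ 0) (hX' : qPoch (q * A / v') q m' ≠ 0)
    (hAm : qPoch A q m ≠ 0) (hAm2 : 1 - A * q ^ (2 * m) ≠ 0) :
    HasSum
      (fun l => (1 - y * q ^ (2 * l)) / (1 - y)
        * (qPoch (q * y / B) q l * qPoch y q l / (qPoch q q l * qPoch B q l))
        * (B / (q * y)) ^ l * biorthPhi q y A B v l m * biorthPhi q y A B v' l m')
      (biorthConst q y A B v v' * (B / (q * y)) ^ m * ((1 - A) / (1 - A * q ^ (2 * m)))
        * (qPoch q q m * qPoch (q * A / B) q m * qPoch v q m * qPoch v' q m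
          / (qPoch A q m * qPoch B q m * qPoch (q * A / v') q m * qPoch (q * A / v) q m))
        * if m = m' then 1 else 0) := by
  have hAB' := notMem_qOmega_of_norm_lt_one hq hq1 hAB
  have hC_ne := qPochInf_ne_zero hq1 hC
  have hvm := qPochInf_mul_pow_ne_zero hq1 hv m
  have hvm' := qPochInf_mul_pow_ne_zero hq1 hv' m'
  set κ := (1 - y) * qPochInf (q * y / B) q * (qPoch (q * A / v) q m * qPochInf (v * q ^ m) q)
    * (qPoch (q * A / v') q m' * qPochInf (v' * q ^ m') q) with hκ
  have hκ0 : κ ≠ 0 := by simp [hκ, hy1, hC_ne, hX, hX', hvm, hvm']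
  have hsum := hasSum_biorthDualWeight_mul_biorthFun hq hq1 hy hA hB0 hB hv0 hv0' hvv hAB hC m m'
  rw [← hasSum_mul_left_iff hκ0]
  have hnorm : κ * (biorthConst q y A B v v' * (B / (q * y)) ^ m
        * ((1 - A) / (1 - A * q ^ (2 * m)))
        * (qPoch q q m * qPoch (q * A / B) q m * qPoch v q m * qPoch v' q m
          / (qPoch A q m * qPoch B q m * qPoch (q * A / v') q m * qPoch (q * A / v) q m))
        * if m = m' then 1 else 0)
      = qPochInf y q * qPochInf (v / B) q * qPochInf (v' / B) q
        * if m = m' then biorthDualNorm q y A B m else 0 := by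
    split_ifs with h
    · subst h
      have hX_cancel := mul_inv_cancel₀ (mul_ne_zero hX hX')
      rw [biorthDualNorm_eq hq1 hAB' hAm hAm2, hκ]
      linear_combination ((B / (q * y)) ^ m * ((1 - A) / (1 - A * q ^ (2 * m)))
        * (qPoch q q m * qPoch (q * A / B) q m / (qPoch A q m * qPoch B q m)))
        * (mul_biorthConst_mul_qPoch (A := A) hq1 hC hv hv' m
          + (1 - y) * qPochInf (q * y / B) q * qPochInf (v * q ^ m) q * qPochInf (v' * q ^ m) q
            * biorthConst q y A B v v' * (qPoch v q m * qPoch v' q m) * hX_cancel)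
    · ring
  rw [hnorm]
  exact hsum.congr_fun fun l =>
    (biorthDualWeight_mul_biorthFun_eq hq1 hy1 hC hv hv' hX hX' l).symm

end Normalization

section Parameters

variable {q t a b c d : ℂ}

theorem qPoch_ne_zero_of_pole {m : ℕ} (hq : q ≠ 0) (ht : t ≠ 0) (ha : a ≠ 0) (hc : c ≠ 0)
    (hm : q ^ (1 - (m : ℤ)) * a * t / c ∉ qOmega q) :
    qPoch (q * (1 / a ^ 2) / (q * t / (a * c))) q m ≠ 0 := by
  rw [show q * (1 / a ^ 2) / (q * t / (a * c)) = (a * t / c)⁻¹ by field_simp]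
  refine qPoch_inv_ne_zero hq (div_ne_zero (mul_ne_zero ha ht) hc) ?_
  rwa [← mul_div_assoc, ← mul_assoc]

theorem rationalPhi_eq_biorthPhi {m : ℕ} (hq : q ≠ 0) (hq1 : ‖q‖ < 1) (ht : t ≠ 0)
    (ha : a ≠ 0) (hb : b ≠ 0) (hc : c ≠ 0) (habcd : a * b = c * d)
    (hv : q * t / (a * c) ∉ qOmega q) (hdc : q * d / c ∉ qOmega q)
    (hm : q ^ (1 - (m : ℤ)) * a * t / c ∉ qOmega q) (l : ℕ) :
    rationalPhi q t a b c d l m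
      = biorthPhi q (1 / c ^ 2) (1 / a ^ 2) (1 / (a * b)) (q * t / (a * c)) l m := by
  have hX := qPoch_ne_zero_of_pole hq ht ha hc hm
  have hX_eq : q * (1 / a ^ 2) / (q * t / (a * c)) = c / (a * t) := by field_simp
  rw [biorthPhi, ← rationalPhi_mul_eq_biorthFun hq hq1 ht ha hb hc habcd hv hdc hm,
    mul_one_div_sq_div_one_div hc habcd, hX_eq, mul_div_cancel_right₀]
  exact mul_ne_zero (mul_ne_zero (hX_eq ▸ hX) (qPochInf_mul_pow_ne_zero hq1 hv m))
    (qPochInf_ne_zero hq1 hdc)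

theorem bioConst_eq_biorthConst (hq : q ≠ 0) (ha : a ≠ 0) (hb : b ≠ 0) (hc : c ≠ 0)
    (habcd : a * b = c * d) :
    bioConst q t a b c d = biorthConst q (1 / c ^ 2) (1 / a ^ 2) (1 / (a * b))
      (q * t / (a * c)) (q * t⁻¹ / (a * c)) := by
  have hvB : ∀ s : ℂ, q * s / (a * c) / (1 / (a * b)) = q * b * s / c := fun s => by field_simp
  rw [biorthConst, hvB, hvB, mul_one_div_sq_div_one_div hc habcd,
    mul_one_div_sq_div_one_div ha rfl]
  simp only [bioConst, qPochsInf, List.map_cons, List.map_nil, List.prod_cons, List.prod_nil,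
    mul_one, mul_one_div, mul_assoc]

end Parameters

theorem theorem7p1_general (q : ℂ) (hq : q ≠ 0) (hq1 : ‖q‖ < 1) (t a b c d : ℂ)
    (ht : t ≠ 0) (ha : a ≠ 0) (hb : b ≠ 0) (hc : c ≠ 0) (habcd : a * b = c * d)
    (hden₁ : q * t / (a * c) ∉ qOmega q) (hden₂ : q * t⁻¹ / (a * c) ∉ qOmega q) :
    (‖q * b‖ < ‖a‖ →
      1 / (a * b) ∉ qOmega q → q * d / c ∉ qOmega q → c ^ 2 ≠ 1 →
      ∀ m m' : ℕ,
        q ^ (1 - (m : ℤ)) * a * t / c ∉ qOmega q →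
        q ^ (1 - (m' : ℤ)) * a * t⁻¹ / c ∉ qOmega q →
        (∀ k < m, a ^ 2 ≠ q ^ k) → a ^ 2 ≠ q ^ (2 * m) →
        HasSum
          (fun l : ℕ =>
            (1 - q ^ (2 * l) / c ^ 2) / (1 - 1 / c ^ 2)
              * (qPochs [q * d / c, 1 / c ^ 2] q l / qPochs [q, 1 / (a * b)] q l)
              * (c / (q * d)) ^ l
              * rationalPhi q t a b c d l m
              * rationalPhi q t⁻¹ a b c d l m')
          (bioConst q t a b c d * (c / (q * d)) ^ m
            * ((1 - 1 / a ^ 2) / (1 - q ^ (2 * m) / a ^ 2))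
            * (qPochs [q, q * b / a, q * t / (a * c), q * t⁻¹ / (a * c)] q m
                / qPochs [1 / a ^ 2, 1 / (a * b), c * t / a, c * t⁻¹ / a] q m)
            * (if m = m' then 1 else 0)))
    ∧
    (‖q * d‖ < ‖c‖ →
      q * b / a ∉ qOmega q → a ^ 2 ≠ 1 →
      (∀ m : ℕ, q ^ (1 - (m : ℤ)) * a * t / c ∉ qOmega q) →
      (∀ m : ℕ, q ^ (1 - (m : ℤ)) * a * t⁻¹ / c ∉ qOmega q) →
      ∀ l l' : ℕ,
        (∀ k < l, c ^ 2 ≠ q ^ k) → c ^ 2 ≠ q ^ (2 * l) →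
        HasSum
          (fun m : ℕ =>
            (1 - q ^ (2 * m) / a ^ 2) / (1 - 1 / a ^ 2)
              * (qPochs [1 / a ^ 2, 1 / (a * b), c * t / a, c * t⁻¹ / a] q m
                  / qPochs [q, q * b / a, q * t / (a * c), q * t⁻¹ / (a * c)] q m)
              * (q * d / c) ^ m
              * rationalPhi q t a b c d l m
              * rationalPhi q t⁻¹ a b c d l' m)
          (bioConst q t a b c d * (q * d / c) ^ l
            * ((1 - 1 / c ^ 2) / (1 - q ^ (2 * l) / c ^ 2))
            * (qPochs [q, 1 / (c * d)] q l / qPochs [1 / c ^ 2, q * d / c] q l)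
            * (if l = l' then 1 else 0))) := by
  have hC_eq : q * (1 / c ^ 2) / (1 / (a * b)) = q * d / c := mul_one_div_sq_div_one_div hc habcd
  have hAB_eq : q * (1 / a ^ 2) / (1 / (a * b)) = q * b / a := mul_one_div_sq_div_one_div ha rfl
  have hz_eq : 1 / (a * b) / (q * (1 / c ^ 2)) = c / (q * d) := by rw [habcd]; field_simp
  have hX_eq : q * (1 / a ^ 2) / (q * t / (a * c)) = c * t⁻¹ / a := by field_simp
  have hX_eq' : q * (1 / a ^ 2) / (q * t⁻¹ / (a * c)) = c * t / a := by field_simp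
  have hvv : q * t / (a * c) * (q * t⁻¹ / (a * c)) = q ^ 2 * (1 / c ^ 2) * (1 / a ^ 2) := by
    field_simp
  have ht' := inv_ne_zero ht
  have hy0 := one_div_ne_zero (pow_ne_zero 2 hc)
  have hA0 := one_div_ne_zero (pow_ne_zero 2 ha)
  have hB0 := one_div_ne_zero (mul_ne_zero ha hb)
  have hv0 := div_ne_zero (mul_ne_zero hq ht) (mul_ne_zero ha hc)
  have hv0' := div_ne_zero (mul_ne_zero hq ht') (mul_ne_zero ha hc)
  rw [bioConst_eq_biorthConst hq ha hb hc habcd]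
  constructor
  · intro hqb hB hdc hc1 m m' hm hm' ham ham2
    have h := hasSum_biorthPhi_degree (m := m) (m' := m') hq hq1 hy0
      (by simpa only [mul_one] using one_sub_one_div_sq_mul_ne_zero hc hc1) hA0 hB0 hB hv0 hv0' hvv
      (by rwa [hAB_eq, norm_div, div_lt_one (norm_pos_iff.mpr ha)]) (by rwa [hC_eq]) hden₁ hden₂
      (qPoch_ne_zero_of_pole hq ht ha hc hm) (qPoch_ne_zero_of_pole hq ht' ha hc hm')
      (qPoch_one_div_sq_ne_zero ha ham) (one_sub_one_div_sq_mul_ne_zero ha ham2)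
    simp only [hC_eq, hAB_eq, hz_eq, hX_eq, hX_eq', one_div_mul_eq_div] at h
    simpa only [rationalPhi_eq_biorthPhi hq hq1 ht ha hb hc habcd hden₁ hdc hm,
      rationalPhi_eq_biorthPhi hq hq1 ht' ha hb hc habcd hden₂ hdc hm', qPochs, List.map_cons,
      List.map_nil, List.prod_cons, List.prod_nil, mul_one, ← mul_assoc] using h
  · intro hqd hAB ha1 hm hm' l l' hcl hcl2
    have hdc : ‖q * d / c‖ < 1 := by rwa [norm_div, div_lt_one (norm_pos_iff.mpr hc)]
    have hdc' := notMem_qOmega_of_norm_lt_one hq hq1 hdc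
    have h := hasSum_biorthPhi_argument (l := l) hq hq1 hy0 hA0
      (by simpa only [mul_one] using one_sub_one_div_sq_mul_ne_zero ha ha1) hB0 hv0 hv0' hvv
      (by rwa [hC_eq]) (by rwa [hAB_eq]) hden₁ hden₂
      (fun m => qPoch_ne_zero_of_pole hq ht ha hc (hm m))
      (fun m => qPoch_ne_zero_of_pole hq ht' ha hc (hm' m))
      (qPoch_one_div_sq_ne_zero hc hcl) (one_sub_one_div_sq_mul_ne_zero hc hcl2) l'
    simp only [hC_eq, hAB_eq, hX_eq, hX_eq', one_div_mul_eq_div] at h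
    simpa only [rationalPhi_eq_biorthPhi hq hq1 ht ha hb hc habcd hden₁ hdc' (hm _),
      rationalPhi_eq_biorthPhi hq hq1 ht' ha hb hc habcd hden₂ hdc' (hm' _), ← habcd, qPochs,
      List.map_cons, List.map_nil, List.prod_cons, List.prod_nil, mul_one, ← mul_assoc] using h

theorem theorem7p1 (q : ℝ) (hq0 : 0 < q) (hq1 : q < 1) (t a b c d : ℂ)
    (ht : t ≠ 0) (ha : a ≠ 0) (hb : b ≠ 0) (hc : c ≠ 0) (hd : d ≠ 0)
    (habcd : a * b = c * d)
    (hden₁ : q * t / (a * c) ∉ qOmega q) (hden₂ : q * t⁻¹ / (a * c) ∉ qOmega q) :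
    -- first relation, summed over `l`
    (‖q * b‖ < ‖a‖ →
      1 / (a * b) ∉ qOmega q → q * d / c ∉ qOmega q → c ^ 2 ≠ 1 →
      ∀ m m' : ℕ,
        (q : ℂ) ^ (1 - (m : ℤ)) * a * t / c ∉ qOmega q →
        (q : ℂ) ^ (1 - (m' : ℤ)) * a * t⁻¹ / c ∉ qOmega q →
        (∀ k < m, a ^ 2 ≠ q ^ k) → a ^ 2 ≠ q ^ (2 * m) →
        HasSum
          (fun l : ℕ =>
            (1 - q ^ (2 * l) / c ^ 2) / (1 - 1 / c ^ 2)
              * (qPochs [q * d / c, 1 / c ^ 2] q l / qPochs [(q : ℂ), 1 / (a * b)] q l)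
              * (c / (q * d)) ^ l
              * rationalPhi q t a b c d l m
              * rationalPhi q t⁻¹ a b c d l m')
          (bioConst q t a b c d * (c / (q * d)) ^ m
            * ((1 - 1 / a ^ 2) / (1 - q ^ (2 * m) / a ^ 2))
            * (qPochs [(q : ℂ), q * b / a, q * t / (a * c), q * t⁻¹ / (a * c)] q m
                / qPochs [1 / a ^ 2, 1 / (a * b), c * t / a, c * t⁻¹ / a] q m)
            * (if m = m' then 1 else 0)))
    ∧
    -- second relation, summed over `m`
    (‖q * d‖ < ‖c‖ →
      q * b / a ∉ qOmega q → a ^ 2 ≠ 1 →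
      (∀ m : ℕ, (q : ℂ) ^ (1 - (m : ℤ)) * a * t / c ∉ qOmega q) →
      (∀ m : ℕ, (q : ℂ) ^ (1 - (m : ℤ)) * a * t⁻¹ / c ∉ qOmega q) →
      ∀ l l' : ℕ,
        (∀ k < l, c ^ 2 ≠ q ^ k) → c ^ 2 ≠ q ^ (2 * l) →
        HasSum
          (fun m : ℕ =>
            (1 - q ^ (2 * m) / a ^ 2) / (1 - 1 / a ^ 2)
              * (qPochs [1 / a ^ 2, 1 / (a * b), c * t / a, c * t⁻¹ / a] q m
                  / qPochs [(q : ℂ), q * b / a, q * t / (a * c), q * t⁻¹ / (a * c)] q m)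
              * (q * d / c) ^ m
              * rationalPhi q t a b c d l m
              * rationalPhi q t⁻¹ a b c d l' m)
          (bioConst q t a b c d * (q * d / c) ^ l
            * ((1 - 1 / c ^ 2) / (1 - q ^ (2 * l) / c ^ 2))
            * (qPochs [(q : ℂ), 1 / (c * d)] q l / qPochs [1 / c ^ 2, q * d / c] q l)
            * (if l = l' then 1 else 0))) :=
  theorem7p1_general q (Complex.ofReal_ne_zero.mpr hq0.ne')
    (by rwa [Complex.norm_real, Real.norm_of_nonneg hq0.le]) t a b c d ht ha hb hc habcd hden₁ hden₂
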